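/- Let $V=\mathbb Z^2$, $\tilde V$ and $E$ be the sets of vertices, faces and unoriented edges of the infinite square lattice in the plane, and let $\mathcal A$ be the quasi-local algebra of a system of qubits on the edges: the $C^\ast$-closure of $\mathcal A_{\rm loc}=\bigcup_\Lambda \mathcal A_\Lambda$, where $\Lambda$ runs over the finite subsets of $E$, $\mathcal A_\Lambda=\mathbb B\big(\bigotimes_{e\in\Lambda}\mathbb C^2\big)$, and $\mathcal A_\Lambda\subseteq\mathcal A_{\Lambda'}$ through $a\mapsto a\otimes 1_{\Lambda'\setminus\Lambda}$ for $\Lambda\subseteq\Lambda'$. For $v\in V$ and $\tilde v\in\tilde V$ let $$A_v=\prod_{e\ni v}\sigma^x_e,\qquad B_{\tilde v}=\prod_{e\in\tilde v}\sigma^z_e$$ be the star and face operators of Kitaev's toric code, where $\sigma^x_e,\sigma^z_e\in\mathcal A_{\{e\}}$ are the Pauli matrices at $e$, and $e\in\tilde v$ means that $e$ belongs to the boundary of the face $\tilde v$. Put $W=V\sqcup\tilde V$, let $S_w=A_w$ for $w\in V$ and $S_w=B_w$ for $w\in\tilde V$, and let $\mathcal C=C^\ast\{S_w : w\in W\}\subseteq\mathcal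 A$. Let $\Omega=\{-1,1\}^W$ be the set of functions $f\colon W\to\{-1,1\}$. Then $\mathcal A$ is isomorphic to the UHF algebra $M_{2^\infty}$, and the following hold. 1. For every $f\in\Omega$ there is exactly one (continuous) unital multiplicative linear functional $\omega_f$ on $\mathcal C$ with $\omega_f(S_w)=f(w)$ for all $w\in W$, and the pure states of $\mathcal C$ are exactly the functionals $\omega_f$, $f\in\Omega$. 2. For every $f\in\Omega$ there is a pure state of $\mathcal A$ that extends $\omega_f$, and it is the only state of $\mathcal A$ that extends $\omega_f$. 3. $\mathcal C$ is a $C^\ast$-diagonal of $\mathcal A\cong M_{2^\infty}$. That is, $\mathcal C$ is a sub-$C^\ast$-algebra of $\mathcal A$ such that: (a) $\mathcal C$ is a masa, meaning that the relative commutant of $\mathcal C$ in $\mathcal A$ is $\mathcal C$ itself; (b) $\mathcal C$ is regular, meaning that the normalizers of $\mathcal C$, i.e. the elements $a\in\mathcal A$ with $a\,\mathcal C\,a^\ast\cup a^\ast\mathcal C\,a\subseteq\mathcal C$, generate $\mathcal A$ as a $C^\ast$-algebra; (c) $\mathcal C$ has the unique extension property, meaning that every pure state of $\mathcal C$ has exactly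 one extension to a pure state of $\mathcal A$. -/

import Mathlib

noncomputable section

/-! ### The quasi-local algebra of a system of qubits indexed by a set `E` -/

namespace SpinSystem

variable {E : Type}

/-- Configurations of classical bits on `E`: labels of the product basis vectors. -/
abbrev Config (E : Type) : Type := E → Fin 2

/-- The Hilbert space on which the local algebras are represented: it has an orthonormal basis
labelled by all configurations. For every finite `Λ` it is `ℋ_Λ ⊗ ℋ'`, with `ℋ_Λ = ⊗_{e ∈ Λ} ℂ²`
and `ℋ'` the space with basis the configurations outside `Λ`. -/
abbrev ConfigSpace (E : Type) : Type := lp (fun _ : Config E => ℂ) 2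

/-- The matrix algebra `𝒜_Λ = 𝔹(ℋ_Λ)`, written in the product basis of `ℋ_Λ = ⊗_{e ∈ Λ} ℂ²`. -/
abbrev LocalMatrix (Λ : Finset E) : Type := Matrix (Λ → Fin 2) (Λ → Fin 2) ℂ

/-- Restriction of a configuration to `Λ`. -/
def restr (Λ : Finset E) (s : Config E) : Λ → Fin 2 := fun e => s e

/-- Translating the configurations by `u` preserves square summability (and the norm). -/
theorem memℓp_shift (u : Config E) (ψ : ConfigSpace E) :
    Memℓp (fun s : Config E => ψ (s + u)) 2 := by
  refine memℓp_gen ?_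
  exact ((Equiv.addRight u).summable_iff (f := fun s => ‖ψ s‖ ^ (2 : ENNReal).toReal)).2
    ((lp.memℓp ψ).summable (by norm_num))

theorem norm_shift (u : Config E) (ψ : ConfigSpace E) :
    ‖(⟨fun s : Config E => ψ (s + u), memℓp_shift u ψ⟩ : ConfigSpace E)‖ = ‖ψ‖ := by
  rw [lp.norm_eq_tsum_rpow (by norm_num), lp.norm_eq_tsum_rpow (by norm_num)]
  congr 1
  exact (Equiv.addRight u).tsum_eq (fun s => ‖ψ s‖ ^ (2 : ENNReal).toReal)

variable [DecidableEq E]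

/-- The configuration that is `t` on `Λ` and `s` off `Λ`. -/
def patch (Λ : Finset E) (s : Config E) (t : Λ → Fin 2) : Config E :=
  fun e => if h : e ∈ Λ then t ⟨e, h⟩ else s e

theorem restr_patch (Λ : Finset E) (s : Config E) (t : Λ → Fin 2) :
    restr Λ (patch Λ s t) = t := by
  funext e
  simp [restr, patch]

theorem patch_patch (Λ : Finset E) (s : Config E) (t t' : Λ → Fin 2) :
    patch Λ (patch Λ s t) t' = patch Λ s t' := by
  funext e
  by_cases h : e ∈ Λ <;> simp [patch, h]

theorem patch_restr (Λ : Finset E) (s : Config E) : patch Λ s (restr Λ s) = s := by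
  funext e
  by_cases h : e ∈ Λ <;> simp [patch, restr]

/-- `(a ⊗ 1) ψ` for a matrix `a` on `Λ`, as a function of configurations. -/
def localFun (Λ : Finset E) (a : LocalMatrix Λ) (ψ : Config E → ℂ) : Config E → ℂ :=
  fun s => ∑ t : Λ → Fin 2, a (restr Λ s) t * ψ (patch Λ s t)

theorem patch_eq_add (Λ : Finset E) (s : Config E) (t : Λ → Fin 2) :
    patch Λ s t = s + patch Λ 0 (t - restr Λ s) := by
  funext e
  by_cases h : e ∈ Λ <;> simp [patch, h, restr]

theorem localFun_eq (Λ : Finset E) (a : LocalMatrix Λ) (ψ : Config E → ℂ) (s : Config E) :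
    localFun Λ a ψ s =
      ∑ u : Λ → Fin 2, a (restr Λ s) (restr Λ s + u) * ψ (s + patch Λ 0 u) := by
  unfold localFun
  refine Fintype.sum_equiv (Equiv.subRight (restr Λ s)) _ _ fun t => ?_
  rw [patch_eq_add]
  simp

theorem norm_entry_le (Λ : Finset E) (a : LocalMatrix Λ) (i j : Λ → Fin 2) :
    ‖a i j‖ ≤ ∑ i, ∑ j, ‖a i j‖ :=
  (Finset.single_le_sum (f := fun j => ‖a i j‖) (fun _ _ => norm_nonneg _)
    (Finset.mem_univ j)).trans
    (Finset.single_le_sum (f := fun i => ∑ j, ‖a i j‖)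
      (fun _ _ => Finset.sum_nonneg fun _ _ => norm_nonneg _) (Finset.mem_univ i))

theorem memℓp_term (Λ : Finset E) (a : LocalMatrix Λ) (ψ : ConfigSpace E) (u : Λ → Fin 2) :
    Memℓp (fun s : Config E => a (restr Λ s) (restr Λ s + u) * ψ (s + patch Λ 0 u)) 2 := by
  refine Memℓp.mono' ((memℓp_shift (patch Λ 0 u) ψ).const_mul
    ((∑ i, ∑ j, ‖a i j‖ : ℝ) : ℂ)) fun s => ?_
  rw [norm_mul, norm_mul, Complex.norm_real]
  gcongr
  exact (norm_entry_le Λ a _ _).trans (Real.le_norm_self _)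

theorem norm_term_le (Λ : Finset E) (a : LocalMatrix Λ) (ψ : ConfigSpace E) (u : Λ → Fin 2) :
    ‖(⟨_, memℓp_term Λ a ψ u⟩ : ConfigSpace E)‖ ≤ (∑ i, ∑ j, ‖a i j‖) * ‖ψ‖ := by
  have hC : 0 ≤ ∑ i, ∑ j, ‖a i j‖ :=
    Finset.sum_nonneg fun _ _ => Finset.sum_nonneg fun _ _ => norm_nonneg _
  have h := lp.norm_mono (p := 2) (by norm_num) (x := ⟨_, memℓp_term Λ a ψ u⟩)
    (y := ((∑ i, ∑ j, ‖a i j‖ : ℝ) : ℂ) • (⟨_, memℓp_shift (patch Λ 0 u) ψ⟩ : ConfigSpace E))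
    (fun s => by
      change ‖a (restr Λ s) (restr Λ s + u) * ψ (s + patch Λ 0 u)‖ ≤
        ‖((∑ i, ∑ j, ‖a i j‖ : ℝ) : ℂ) * ψ (s + patch Λ 0 u)‖
      rw [norm_mul, norm_mul, Complex.norm_real]
      gcongr
      exact (norm_entry_le Λ a _ _).trans (Real.le_norm_self _))
  rw [norm_smul, norm_shift, Complex.norm_real, Real.norm_of_nonneg hC] at h
  exact h

theorem memℓp_localFun (Λ : Finset E) (a : LocalMatrix Λ) (ψ : ConfigSpace E) :
    Memℓp (localFun Λ a ψ) 2 := by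
  have h := Memℓp.finsetSum (Finset.univ : Finset (Λ → Fin 2)) fun u _ => memℓp_term Λ a ψ u
  convert h using 1
  funext s
  exact localFun_eq Λ a ψ s

theorem norm_localFun_le (Λ : Finset E) (a : LocalMatrix Λ) (ψ : ConfigSpace E) :
    ‖(⟨_, memℓp_localFun Λ a ψ⟩ : ConfigSpace E)‖ ≤
      (Fintype.card (Λ → Fin 2) * ∑ i, ∑ j, ‖a i j‖) * ‖ψ‖ := by
  have h : (⟨_, memℓp_localFun Λ a ψ⟩ : ConfigSpace E) =
      ∑ u : Λ → Fin 2, (⟨_, memℓp_term Λ a ψ u⟩ : ConfigSpace E) := by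
    apply lp.ext
    rw [lp.coeFn_sum]
    funext s
    rw [Finset.sum_apply]
    exact localFun_eq Λ a ψ s
  rw [h]
  refine (norm_sum_le_of_le _ fun u _ => norm_term_le Λ a ψ u).trans ?_
  rw [Finset.sum_const, nsmul_eq_mul, Finset.card_univ, mul_assoc]

/-- The bounded operator `a ⊗ 1`. -/
def localOp (Λ : Finset E) (a : LocalMatrix Λ) : ConfigSpace E →L[ℂ] ConfigSpace E :=
  LinearMap.mkContinuous
    { toFun := fun ψ => ⟨localFun Λ a ψ, memℓp_localFun Λ a ψ⟩
      map_add' := fun ψ φ => lp.ext <| by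
        funext s
        change localFun Λ a _ s = localFun Λ a ψ s + localFun Λ a φ s
        simp [localFun, mul_add, Finset.sum_add_distrib]
      map_smul' := fun c ψ => lp.ext <| by
        funext s
        change localFun Λ a _ s = c * localFun Λ a ψ s
        simp only [localFun, lp.coeFn_smul, Pi.smul_apply, smul_eq_mul, Finset.mul_sum]
        exact Finset.sum_congr rfl fun _ _ => by ring }
    _ (norm_localFun_le Λ a)

theorem localOp_apply (Λ : Finset E) (a : LocalMatrix Λ) (ψ : ConfigSpace E) (s : Config E) :
    localOp Λ a ψ s = ∑ t : Λ → Fin 2, a (restr Λ s) t * ψ (patch Λ s t) := rfl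

open Classical in
/-- The matrix entries of `a ⊗ 1` in the product basis. -/
theorem localOp_single (Λ : Finset E) (a : LocalMatrix Λ) (s t : Config E) (c : ℂ) :
    localOp Λ a (lp.single 2 t c) s =
      if ∀ e ∉ Λ, s e = t e then a (restr Λ s) (restr Λ t) * c else 0 := by
  classical
  rw [localOp_apply]
  by_cases h : ∀ e ∉ Λ, s e = t e
  · rw [if_pos h, Finset.sum_eq_single (restr Λ t)]
    · have : patch Λ s (restr Λ t) = t := by
        funext e
        by_cases he : e ∈ Λ <;> simp [patch, he, restr, h]
      rw [this, lp.single_apply_self]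
    · intro r _ hr
      rw [lp.single_apply_ne, mul_zero]
      rintro rfl
      exact hr (restr_patch Λ s r).symm
    · simp
  · rw [if_neg h]
    refine Finset.sum_eq_zero fun r _ => ?_
    rw [lp.single_apply_ne, mul_zero]
    rintro rfl
    exact h fun e he => by simp [patch, he]

theorem localOp_star (Λ : Finset E) (a : LocalMatrix Λ) :
    localOp Λ (star a) = star (localOp Λ a) := by
  classical
  refine lp.ext_continuousLinearMap (by norm_num) fun t => ?_
  refine ContinuousLinearMap.ext fun c => lp.ext (funext fun s => ?_)
  change localOp Λ (star a) (lp.single 2 t c) s = (star (localOp Λ a) (lp.single 2 t c)) s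
  have h1 := lp.inner_single_left (𝕜 := ℂ) s (1 : ℂ) (star (localOp Λ a) (lp.single 2 t c))
  rw [ContinuousLinearMap.star_eq_adjoint, ContinuousLinearMap.adjoint_inner_right,
    lp.inner_single_right, localOp_single] at h1
  rw [localOp_single, ContinuousLinearMap.star_eq_adjoint]
  have h2 : ∀ z : ℂ, inner ℂ (1 : ℂ) z = z := fun z => by simp
  rw [h2] at h1
  rw [← h1]
  by_cases h : ∀ e ∉ Λ, s e = t e
  · rw [if_pos h, if_pos fun e he => (h e he).symm]
    simp [Matrix.star_apply, mul_comm]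
  · rw [if_neg h, if_neg fun h' => h fun e he => (h' e he).symm]
    simp

theorem localOp_mul (Λ : Finset E) (a b : LocalMatrix Λ) :
    localOp Λ (a * b) = localOp Λ a * localOp Λ b := by
  ext ψ s
  change localOp Λ (a * b) ψ s = localOp Λ a (localOp Λ b ψ) s
  simp only [localOp_apply, restr_patch, patch_patch, Matrix.mul_apply, Finset.sum_mul,
    Finset.mul_sum]
  rw [Finset.sum_comm]
  exact Finset.sum_congr rfl fun _ _ => Finset.sum_congr rfl fun _ _ => by ring

theorem localOp_algebraMap (Λ : Finset E) (c : ℂ) :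
    localOp Λ (algebraMap ℂ _ c) = algebraMap ℂ _ c := by
  ext ψ s
  change localOp Λ (algebraMap ℂ _ c) ψ s = c * ψ s
  rw [localOp_apply, Finset.sum_eq_single (restr Λ s)]
  · simp [patch_restr, Matrix.algebraMap_matrix_apply]
  · intro t _ ht
    simp [Matrix.algebraMap_matrix_apply, ht.symm]
  · simp

/-- The representation `a ↦ a ⊗ 1` of the matrix algebra `𝒜_Λ`. -/
def localEmbed (Λ : Finset E) :
    LocalMatrix Λ →⋆ₐ[ℂ] (ConfigSpace E →L[ℂ] ConfigSpace E) where
  toFun := localOp Λ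
  map_one' := by simpa using localOp_algebraMap Λ 1
  map_mul' := localOp_mul Λ
  map_zero' := by simpa using localOp_algebraMap Λ 0
  map_add' a b := by
    ext ψ s
    change localOp Λ (a + b) ψ s = localOp Λ a ψ s + localOp Λ b ψ s
    simp [localOp_apply, add_mul, Finset.sum_add_distrib]
  commutes' := localOp_algebraMap Λ
  map_star' := localOp_star Λ

/-- The natural inclusion `a ↦ a ⊗ 1_{Λ' \ Λ}` of matrix algebras, for `Λ ⊆ Λ'`. -/
def extendMatrix {Λ Λ' : Finset E} (h : Λ ⊆ Λ') (a : LocalMatrix Λ) : LocalMatrix Λ' :=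
  Matrix.of fun s t => if ∀ e : Λ', (e : E) ∉ Λ → s e = t e then
    a (fun e => s ⟨e, h e.2⟩) (fun e => t ⟨e, h e.2⟩) else 0

/-- Each `𝒜_Λ` is represented faithfully, so that the representation is isometric. -/
theorem localEmbed_injective (Λ : Finset E) : Function.Injective (localEmbed Λ) := by
  classical
  intro a b hab
  ext i j
  have h := congrArg (fun T : ConfigSpace E →L[ℂ] ConfigSpace E =>
    T (lp.single 2 (patch Λ 0 j) (1 : ℂ)) (patch Λ 0 i)) hab
  change localOp Λ a _ _ = localOp Λ b _ _ at h
  rw [localOp_single, localOp_single, restr_patch, restr_patch,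
    if_pos fun e he => by simp [patch, he], if_pos fun e he => by simp [patch, he]] at h
  simpa using h

/-- The representations are compatible with the natural inclusions. Hence the union of their
ranges is the algebra `⋃_Λ 𝒜_Λ` of local observables. -/
theorem localEmbed_extendMatrix {Λ Λ' : Finset E} (h : Λ ⊆ Λ') (a : LocalMatrix Λ) :
    localEmbed Λ' (extendMatrix h a) = localEmbed Λ a := by
  classical
  refine lp.ext_continuousLinearMap (𝕜 := ℂ) (by norm_num) fun t => ?_
  refine ContinuousLinearMap.ext fun c => lp.ext (funext fun s => ?_)
  change localOp Λ' (extendMatrix h a) (lp.single 2 t c) s = localOp Λ a (lp.single 2 t c) s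
  rw [localOp_single, localOp_single]
  by_cases h1 : ∀ e ∉ Λ, s e = t e
  · rw [if_pos h1, if_pos fun e he => h1 e fun he' => he (h he')]
    congr 1
    exact if_pos (c := ∀ e : Λ', (e : E) ∉ Λ → restr Λ' s e = restr Λ' t e)
      fun e he => h1 e he
  · rw [if_neg h1]
    by_cases h2 : ∀ e ∉ Λ', s e = t e
    · rw [if_pos h2]
      refine mul_eq_zero_of_left (if_neg fun h3 => ?_) c
      refine h1 fun e he => ?_
      by_cases he' : e ∈ Λ'
      · exact h3 ⟨e, he'⟩ he
      · exact h2 e he'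
    · rw [if_neg h2]

variable (E) in
/-- The algebra `𝒜_loc = ⋃_Λ 𝒜_Λ` of local observables (the supremum is over a directed family). -/
def localAlgebra : StarSubalgebra ℂ (ConfigSpace E →L[ℂ] ConfigSpace E) :=
  ⨆ Λ : Finset E, (localEmbed Λ).range

variable (E) in
/-- The quasi-local algebra: the C⋆-closure of the algebra of local observables. -/
abbrev quasiLocal : StarSubalgebra ℂ (ConfigSpace E →L[ℂ] ConfigSpace E) :=
  (localAlgebra E).topologicalClosure

variable (E) in
/-- The quasi-local algebra `𝒜 = ⊗_{e ∈ E} M₂(ℂ)` as a C⋆-algebra. -/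
abbrev QuasiLocal : Type := quasiLocal E

instance : CStarAlgebra (QuasiLocal E) :=
  StarSubalgebra.cstarAlgebra (quasiLocal E)
    (h_closed := StarSubalgebra.isClosed_topologicalClosure _)

theorem localEmbed_mem (Λ : Finset E) (a : LocalMatrix Λ) : localEmbed Λ a ∈ quasiLocal E :=
  StarSubalgebra.le_topologicalClosure _
    ((le_iSup (fun Λ : Finset E => (localEmbed Λ).range) Λ) ⟨a, rfl⟩)

/-- The matrix `m ∈ M₂(ℂ)` acting on the site `e`, as an element of `𝒜_{e} ⊆ 𝒜`. -/
def siteOp (e : E) (m : Matrix (Fin 2) (Fin 2) ℂ) : QuasiLocal E :=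
  ⟨localEmbed {e} (Matrix.of fun s t => m (s ⟨e, Finset.mem_singleton_self e⟩)
    (t ⟨e, Finset.mem_singleton_self e⟩)), localEmbed_mem _ _⟩

/-- The Pauli matrix `σ^x` at the site `e`. -/
def sigmaX (e : E) : QuasiLocal E := siteOp e !![0, 1; 1, 0]

/-- The Pauli matrix `σ^z` at the site `e`. -/
def sigmaZ (e : E) : QuasiLocal E := siteOp e !![1, 0; 0, -1]

end SpinSystem

/-! ### States, and C⋆-diagonals -/

namespace CStarDiagonal

section States

variable {A : Type*} [Ring A] [StarRing A] [Algebra ℂ A] [TopologicalSpace A]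

open scoped ComplexOrder in
/-- A state: a positive linear functional that takes the value `1` at the unit. -/
def IsState (φ : A →L[ℂ] ℂ) : Prop := (∀ a : A, 0 ≤ φ (star a * a)) ∧ φ 1 = 1

/-- A pure state: an extreme point of the convex set of states. -/
def IsPureState (φ : A →L[ℂ] ℂ) : Prop := φ ∈ Set.extremePoints ℝ {ψ : A →L[ℂ] ℂ | IsState ψ}

/-- `η` is an extension to `A` of the functional `ω` on the subalgebra `B`. -/
def Extends [StarModule ℂ A] {B : StarSubalgebra ℂ A} (ω : B →L[ℂ] ℂ) (η : A →L[ℂ] ℂ) : Prop :=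
  ∀ b : B, η (b : A) = ω b

end States

variable {A : Type*} [CStarAlgebra A]

/-- `B` is maximal abelian: its relative commutant in `A` is `B` itself. -/
def IsMasa (B : StarSubalgebra ℂ A) : Prop := Set.centralizer (B : Set A) = (B : Set A)

/-- `a` is a normalizer of `B`: `a B a* ∪ a* B a ⊆ B`. -/
def IsNormalizer (B : StarSubalgebra ℂ A) (a : A) : Prop :=
  ∀ b ∈ B, a * b * star a ∈ B ∧ star a * b * a ∈ B

/-- `B` is regular: its normalizers generate `A` as a C⋆-algebra. -/
def IsRegular (B : StarSubalgebra ℂ A) : Prop :=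
  (StarAlgebra.adjoin ℂ {a : A | IsNormalizer B a}).topologicalClosure = ⊤

/-- The unique extension property: every pure state of `B` has exactly one extension to a pure
state of `A`. -/
def HasUniqueExtension (B : StarSubalgebra ℂ A) : Prop :=
  ∀ ω : B →L[ℂ] ℂ, IsPureState ω → ∃! η : A →L[ℂ] ℂ, IsPureState η ∧ Extends ω η

/-- `B` is a C⋆-diagonal of `A`: a (norm closed) sub-C⋆-algebra that is a regular masa and has the
unique extension property. -/
structure IsCStarDiagonal (B : StarSubalgebra ℂ A) : Prop where
  isClosed : IsClosed (B : Set A)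
  isMasa : IsMasa B
  isRegular : IsRegular B
  hasUniqueExtension : HasUniqueExtension B

variable (A) in
/-- `A` is the UHF algebra `M_{2^∞}`: the closure of the union of an increasing sequence of unital
⋆-subalgebras, the `n`-th of which is a copy of the algebra of `2ⁿ × 2ⁿ` matrices. -/
def IsUHFTwoInfty : Prop :=
  ∃ M : ℕ → StarSubalgebra ℂ A, Monotone M ∧
    (∀ n, Nonempty (M n ≃⋆ₐ[ℂ] Matrix (Fin (2 ^ n)) (Fin (2 ^ n)) ℂ)) ∧
    (⨆ n, M n).topologicalClosure = ⊤

end CStarDiagonal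

/-! ### The toric code -/

namespace ToricCode

open SpinSystem CStarDiagonal

/-- The vertices of the square lattice. -/
abbrev Vertex : Type := ℤ × ℤ

/-- The faces of the square lattice, each named by its lower left corner. -/
abbrev Face : Type := ℤ × ℤ

/-- The unoriented edges of the square lattice: `(v, false)` is the horizontal edge from `v` to
`v + (1, 0)`, and `(v, true)` is the vertical edge from `v` to `v + (0, 1)`. -/
abbrev Edge : Type := Vertex × Bool

/-- The horizontal edge from `v` to `v + (1, 0)`. -/
def hEdge (v : Vertex) : Edge := (v, false)

/-- The vertical edge from `v` to `v + (0, 1)`. -/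
def vEdge (v : Vertex) : Edge := (v, true)

/-- The quasi-local algebra of the qubits on the edges of the square lattice. -/
abbrev Algebra : Type := QuasiLocal Edge

/-- The star operator `A_v = ∏_{e ∋ v} σ_e^x` (the factors commute). -/
def starOp (v : Vertex) : Algebra :=
  sigmaX (hEdge v) * sigmaX (vEdge v) * sigmaX (hEdge (v - (1, 0))) * sigmaX (vEdge (v - (0, 1)))

/-- The face operator `B_p = ∏_{e ∈ p} σ_e^z` (the factors commute): the edges in the boundary of
the face with lower left corner `p` are the bottom, left, top and right one. -/
def faceOp (p : Face) : Algebra :=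
  sigmaZ (hEdge p) * sigmaZ (vEdge p) * sigmaZ (hEdge (p + (0, 1))) * sigmaZ (vEdge (p + (1, 0)))

/-- `S_w`, for `w` a vertex or a face: the star operator or the face operator of `w`. -/
def stabilizer : Vertex ⊕ Face → Algebra := Sum.elim starOp faceOp

/-- The sub-C⋆-algebra `𝒞 = C⋆{A_v, B_p}` generated by the star and face operators. -/
def diagonal : StarSubalgebra ℂ Algebra :=
  (StarAlgebra.adjoin ℂ (Set.range stabilizer)).topologicalClosure

theorem stabilizer_mem (w : Vertex ⊕ Face) : stabilizer w ∈ diagonal :=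
  StarSubalgebra.le_topologicalClosure _ (StarAlgebra.subset_adjoin ℂ _ ⟨w, rfl⟩)

/-- `S_w` as an element of `𝒞`. -/
def stabilizerElt (w : Vertex ⊕ Face) : diagonal := ⟨stabilizer w, stabilizer_mem w⟩

/-- `ω` is the evaluation `ω_f` at `f ∈ Ω = {-1, 1}^W`: the multiplicative linear functional on `𝒞`
with `ω(S_w) = f(w)` for all `w`. The group `ℤˣ` is `{-1, 1}`. -/
structure IsEvaluation (f : Vertex ⊕ Face → ℤˣ) (ω : diagonal →L[ℂ] ℂ) : Prop where
  map_one : ω 1 = 1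
  map_mul : ∀ a b, ω (a * b) = ω a * ω b
  map_stabilizer : ∀ w, ω (stabilizerElt w) = ((f w : ℤ) : ℂ)

end ToricCode

end

noncomputable section

/-! ### States, symmetries and purity -/

namespace CStarDiagonal

open scoped ComplexOrder

/-! The Pauli strings `Z^z X^x`, with `x` and `z` finitely supported bit vectors on the edges, span
a dense subalgebra of the quasi-local algebra. Two strings commute or anticommute according to the
mod 2 symplectic form. The stabilizers are commuting self-adjoint strings that square to one.

Everything rests on the dichotomy `mem_diagonal_or_anticomm`. A string that commutes with every star
operator has a cycle as its `z`, and one that commutes with every face operator has a dual cycle as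
its `x`. The plane has no first homology (`exists_boundary`), so `z` is a finite sum of face
boundaries and `x` a finite sum of stars, and the string is a multiple of a product of stabilizers.
Any other string anticommutes with some stabilizer.

Uniqueness of extensions: a state with value `±1` on a symmetry has it in its multiplicative domain
(`IsState.map_symmetry_mul`), hence vanishes on whatever anticommutes with it. An extension of an
evaluation is thus determined on every string, and it inherits purity from this uniqueness. The pure
states of `𝒞` are the evaluations, because a pure state is `±1` on a central symmetry and `±1` are
extreme in `[-1, 1]`.

Existence: a semi-infinite string, cut off to a finite region, flips one stabilizer and leaves
finitely many others alone (`exists_flip`). So every finite syndrome has an eigenvector, and a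
weak-* limit of vector states realizes all of `f` (`exists_state`).

Masa: averaging over conjugation by stabilizers is contractive, fixes the commutant of `𝒞`, and
brings any combination of strings into `𝒞`. Regularity: the Pauli matrices normalize `𝒞`. The UHF
structure comes from an enumeration of the edges. -/

/-- A real affine function that is bounded below has slope zero, and the imaginary part vanishes for
every `t`. -/
theorem eq_zero_of_nonneg_add_smul {k w : ℂ} (h : ∀ t : ℝ, 0 ≤ k + t * w) : w = 0 := by
  have him : ∀ t : ℝ, k.im + t * w.im = 0 := fun t => by
    have := (Complex.le_def.1 (h t)).2
    simpa using this.symm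
  have hre : ∀ t : ℝ, 0 ≤ k.re + t * w.re := fun t => by
    have := (Complex.le_def.1 (h t)).1
    simpa using this
  have h0 := him 0
  have h1 := him 1
  refine Complex.ext ?_ ?_
  · by_contra hw
    have hw' : w.re ≠ 0 := hw
    -- At this `t` the real part would be `-1`.
    have := hre ((-1 - k.re) / w.re)
    rw [div_mul_cancel₀ _ hw'] at this
    linarith
  · simp only [Complex.zero_im]
    linarith

section States

variable {A : Type*} [Ring A] [StarRing A] [Algebra ℂ A] [TopologicalSpace A]

/-- A null vector of the positive form `(a, b) ↦ φ (a* b)` lies in its kernel, on both sides. -/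
theorem IsState.map_mul_eq_zero [StarModule ℂ A] {φ : A →L[ℂ] ℂ} (hφ : IsState φ) {d : A}
    (hd : φ (star d * d) = 0) (a : A) : φ (star d * a) = 0 ∧ φ (star a * d) = 0 := by
  -- Positivity at `l • d + a`; the term quadratic in `l` drops out by `hd`. Real and imaginary `l`
  -- then give the sum and the difference of the two values.
  have key : ∀ l : ℂ, 0 ≤ φ (star a * a) + (star l * φ (star d * a) + l * φ (star a * d)) := by
    intro l
    have h := hφ.1 (l • d + a)
    have e : star (l • d + a) * (l • d + a) =
        (star l * l) • (star d * d) + star l • (star d * a) + l • (star a * d) + star a * a := by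
      simp only [star_add, star_smul, add_mul, mul_add, smul_mul_assoc, mul_smul_comm]
      module
    rw [e] at h
    simp only [map_add, map_smul, hd, smul_eq_mul] at h
    convert h using 1
    ring
  have h1 : φ (star d * a) + φ (star a * d) = 0 := eq_zero_of_nonneg_add_smul (k := φ (star a * a))
    fun t => by
      convert key t using 1
      simp
      ring
  have h2 : Complex.I * (φ (star a * d) - φ (star d * a)) = 0 :=
    eq_zero_of_nonneg_add_smul (k := φ (star a * a)) fun t => by
      convert key (t * Complex.I) using 1
      simp
      ring
  have h3 := (mul_eq_zero.1 h2).resolve_left Complex.I_ne_zero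
  constructor
  · linear_combination (1 / 2 : ℂ) * h1 - (1 / 2 : ℂ) * h3
  · linear_combination (1 / 2 : ℂ) * h1 + (1 / 2 : ℂ) * h3

/-- A symmetry on which a state takes a value `±1` lies in the multiplicative domain. -/
theorem IsState.map_symmetry_mul [StarModule ℂ A] {φ : A →L[ℂ] ℂ} (hφ : IsState φ) {S : A} (hS : star S = S)
    (hS2 : S * S = 1) {c : ℂ} (hc : star c = c) (hc2 : c * c = 1) (hφS : φ S = c) (a : A) :
    φ (S * a) = c * φ a ∧ φ (a * S) = c * φ a := by
  have hd : star (S - c • (1 : A)) = S - c • (1 : A) := by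
    rw [star_sub, hS, star_smul, hc, star_one]
  have h0 : φ (star (S - c • (1 : A)) * (S - c • (1 : A))) = 0 := by
    -- `S - c` is a null vector: `(S - c)² = 1 - 2cS + c²` has the value `1 - c² = 0`.
    rw [hd]
    simp only [sub_mul, mul_sub, hS2, smul_mul_assoc, mul_smul_comm, one_mul, mul_one, map_sub,
      map_smul, hφ.2, hφS, smul_eq_mul]
    linear_combination -hc2
  have h1 := (hφ.map_mul_eq_zero h0 a).1
  have h2 := (hφ.map_mul_eq_zero h0 (star a)).2
  rw [hd] at h1
  rw [star_star] at h2
  simp only [sub_mul, mul_sub, smul_mul_assoc, mul_smul_comm, one_mul, mul_one, map_sub,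
      map_smul, smul_eq_mul, sub_eq_zero] at h1 h2
  exact ⟨h1, h2⟩

/-- `(1 ± S)² = 2(1 ± S)`, so positivity makes `1 ± φ(S)` a nonnegative real. -/
theorem IsState.map_symmetry_bound {φ : A →L[ℂ] ℂ} (hφ : IsState φ) {S : A} (hS : star S = S)
    (hS2 : S * S = 1) : (φ S).im = 0 ∧ -1 ≤ (φ S).re ∧ (φ S).re ≤ 1 := by
  have h1 := hφ.1 (1 + S)
  have h2 := hφ.1 (1 - S)
  simp only [star_add, star_sub, star_one, hS, add_mul, mul_add, sub_mul, mul_sub, one_mul,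
    mul_one, hS2, map_add, map_sub, hφ.2] at h1 h2
  have a1 := (Complex.le_def.1 h1).1
  have a2 := (Complex.le_def.1 h2).1
  have a3 := (Complex.le_def.1 h1).2
  simp at a1 a2 a3
  exact ⟨by linarith, by linarith, by linarith⟩

/-- The compression of a state by a commuting projection of nonzero mass is a state. -/
theorem IsState.compress [ContinuousMul A] {φ : A →L[ℂ] ℂ} (hφ : IsState φ) {p : A}
    (hp : star p = p) (hpp : p * p = p) (hcomm : ∀ a, p * a = a * p) {r : ℝ} (hr : 0 < r)
    (hφp : φ p = r) :
    IsState ((r⁻¹ : ℂ) • φ ∘L ((⟨LinearMap.mulLeft ℂ p, continuous_const_mul p⟩ : A →L[ℂ] A))) := by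
  constructor
  · intro a
    change 0 ≤ (r⁻¹ : ℂ) * φ (p * (star a * a))
    have e : p * (star a * a) = star (p * a) * (p * a) := by
      rw [star_mul, hp, ← mul_assoc, ← mul_assoc, mul_assoc (star a) p p, hpp, hcomm]
    rw [e, ← Complex.ofReal_inv]
    exact mul_nonneg (Complex.zero_le_real.2 (inv_nonneg.2 hr.le)) (hφ.1 _)
  · change (r⁻¹ : ℂ) * φ (p * 1) = 1
    rw [mul_one, hφp]
    exact inv_mul_cancel₀ (by exact_mod_cast hr.ne')

/-- A pure state takes one of the values `±1` on every central symmetry. -/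
theorem IsPureState.map_central_symmetry [StarModule ℂ A] [ContinuousMul A]
    {φ : A →L[ℂ] ℂ} (hφ : IsPureState φ)
    {S : A} (hS : star S = S) (hS2 : S * S = 1) (hcomm : ∀ a, S * a = a * S) :
    φ S = 1 ∨ φ S = -1 := by
  have hst : IsState φ := hφ.1
  obtain ⟨him, hlo, hhi⟩ := hst.map_symmetry_bound hS hS2
  set x := (φ S).re with hx
  have hφS : φ S = (x : ℂ) := Complex.ext rfl (by simpa using him)
  by_contra hne
  rw [not_or, hφS] at hne
  have hlo' : -1 < x := lt_of_le_of_ne hlo fun h => hne.2 (by rw [← h]; simp)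
  have hhi' : x < 1 := lt_of_le_of_ne hhi fun h => hne.1 (by rw [h]; simp)
  have hS2' : S * S = 1 := hS2
  -- If `-1 < x < 1`, both spectral projections `p`, `q` of `S` have positive mass, and `φ` is a
  -- proper convex combination of its compressions by them. Purity makes `φ` equal to its
  -- compression by `p`, which is `1` at `p`, whereas `φ p = (1 + x) / 2`.
  set p : A := (2⁻¹ : ℂ) • (1 + S) with hp
  set q : A := (2⁻¹ : ℂ) • (1 - S) with hq
  have h2 : star (2⁻¹ : ℂ) = 2⁻¹ := by simp
  have hps : star p = p := by rw [hp, star_smul, star_add, star_one, hS, h2]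
  have hqs : star q = q := by rw [hq, star_smul, star_sub, star_one, hS, h2]
  have hpp : p * p = p := by
    rw [hp, smul_mul_smul_comm, add_mul, mul_add, mul_add, hS2, one_mul, mul_one, one_mul]
    module
  have hqq : q * q = q := by
    rw [hq, smul_mul_smul_comm, sub_mul, mul_sub, mul_sub, hS2, one_mul, mul_one, one_mul]
    module
  have hpc : ∀ a, p * a = a * p := fun a => by
    rw [hp, smul_mul_assoc, mul_smul_comm, add_mul, mul_add, hcomm, one_mul, mul_one]
  have hqc : ∀ a, q * a = a * q := fun a => by
    rw [hq, smul_mul_assoc, mul_smul_comm, sub_mul, mul_sub, hcomm, one_mul, mul_one]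
  have hφp : φ p = (((1 + x) / 2 : ℝ) : ℂ) := by
    rw [hp, map_smul, map_add, hst.2, hφS]; push_cast; simp; ring
  have hφq : φ q = (((1 - x) / 2 : ℝ) : ℂ) := by
    rw [hq, map_smul, map_sub, hst.2, hφS]; push_cast; simp; ring
  have hr : 0 < (1 + x) / 2 := by linarith
  have hr' : 0 < (1 - x) / 2 := by linarith
  have s1 := hst.compress hps hpp hpc hr hφp
  have s2 := hst.compress hqs hqq hqc hr' hφq
  have hrc : (((1 + x) / 2 : ℝ) : ℂ) ≠ 0 := by exact_mod_cast hr.ne'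
  have hrc' : (((1 - x) / 2 : ℝ) : ℂ) ≠ 0 := by exact_mod_cast hr'.ne'
  have h := (mem_extremePoints.1 hφ).2 _ s1 _ s2
    ⟨(1 + x) / 2, (1 - x) / 2, hr, hr', by ring, by
      ext a
      change (((1 + x) / 2 : ℝ) : ℂ) * ((((1 + x) / 2 : ℝ) : ℂ)⁻¹ * φ (p * a)) +
        (((1 - x) / 2 : ℝ) : ℂ) * ((((1 - x) / 2 : ℝ) : ℂ)⁻¹ * φ (q * a)) = φ a
      rw [mul_inv_cancel_left₀ hrc, mul_inv_cancel_left₀ hrc', ← map_add, ← add_mul]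
      congr 1
      rw [hp, hq, ← smul_add]
      have : (1 : A) + S + (1 - S) = (2 : ℂ) • (1 : A) := by module
      rw [this, smul_smul, inv_mul_cancel₀ two_ne_zero, one_smul, one_mul]⟩
  have hpv := congrArg (fun ψ : A →L[ℂ] ℂ => ψ p) h.1
  change (((1 + x) / 2 : ℝ) : ℂ)⁻¹ * φ (p * p) = φ p at hpv
  rw [hpp, hφp, inv_mul_cancel₀ hrc] at hpv
  have : (1 : ℝ) = (1 + x) / 2 := by exact_mod_cast hpv
  linarith

end States

end CStarDiagonal

/-! ### Pauli strings and their density -/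

namespace SpinSystem

variable {E : Type}

/-- The sign character of `ZMod 2`. -/
def sgn (a : ZMod 2) : ℂ := if a = 0 then 1 else -1

theorem sgn_zero : sgn 0 = 1 := if_pos rfl

theorem sgn_one : sgn 1 = -1 := if_neg (by decide)

theorem eq_zero_or_one : ∀ k : ZMod 2, k = 0 ∨ k = 1 := by decide

theorem sgn_add (a b : ZMod 2) : sgn (a + b) = sgn a * sgn b := by
  rcases eq_zero_or_one a with rfl | rfl <;> rcases eq_zero_or_one b with rfl | rfl
  · simp [sgn_zero]
  · simp [sgn_zero]
  · simp [sgn_zero]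
  · rw [show (1 + 1 : ZMod 2) = 0 by decide, sgn_zero, sgn_one]
    norm_num

theorem sgn_ne_zero (a : ZMod 2) : sgn a ≠ 0 := by
  unfold sgn
  split_ifs <;> simp

/-- The pairing between finitely supported and arbitrary bit strings. -/
def pair (z : E →₀ ZMod 2) (s : E → ZMod 2) : ZMod 2 := Finsupp.linearCombination (ZMod 2) s z

theorem pair_add_left (z z' : E →₀ ZMod 2) (s : E → ZMod 2) :
    pair (z + z') s = pair z s + pair z' s := map_add _ _ _

theorem pair_add_right (z : E →₀ ZMod 2) (s s' : E → ZMod 2) :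
    pair z (s + s') = pair z s + pair z s' := by
  simp [pair, Finsupp.linearCombination_apply, mul_add, Finsupp.sum_add]

theorem pair_zero_left (s : E → ZMod 2) : pair 0 s = 0 := map_zero _

theorem pair_zero_right (z : E →₀ ZMod 2) : pair z (0 : E → ZMod 2) = 0 := by
  simp [pair]

theorem pair_single (e : E) (k : ZMod 2) (s : E → ZMod 2) :
    pair (Finsupp.single e k) s = k * s e := by simp [pair]

theorem pair_comm (z x : E →₀ ZMod 2) : pair z x = pair x z := by
  induction z using Finsupp.induction_linear with
  | zero => rw [pair_zero_left, Finsupp.coe_zero, pair_zero_right]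
  | add f g hf hg => rw [pair_add_left, hf, hg, Finsupp.coe_add, pair_add_right]
  | single e k =>
    rw [pair_single]
    induction x using Finsupp.induction_linear with
    | zero => simp [pair_zero_left]
    | add f g hf hg => rw [pair_add_left, ← hf, ← hg, Finsupp.add_apply, mul_add]
    | single e' k' =>
      classical
      rw [pair_single]
      simp only [Finsupp.single_apply]
      by_cases h : e = e'
      · subst h; simp [mul_comm]
      · simp [h, Ne.symm h]

theorem linearCombination_single (x : E →₀ ZMod 2) :
    Finsupp.linearCombination (ZMod 2) (fun e : E => Finsupp.single e (1 : ZMod 2)) x = x := by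
  simp [Finsupp.linearCombination_apply]

/-- A string of bits in `ZMod 2`, as a configuration. -/
def toConfig (s : E → ZMod 2) : Config E := fun e => s e

/-- A configuration, as a string of bits in `ZMod 2`. -/
def ofConfig (s : Config E) : E → ZMod 2 := fun e => s e

variable [DecidableEq E]

/-- The amplitude of a vector at a configuration. -/
def amp (ψ : ConfigSpace E) (s : E → ZMod 2) : ℂ := ψ (toConfig s)

/-- The amplitudes of `a ψ`. -/
def act (a : QuasiLocal E) (ψ : ConfigSpace E) (s : E → ZMod 2) : ℂ := amp (a.1 ψ) s

theorem ext_act {a b : QuasiLocal E} (h : ∀ ψ s, act a ψ s = act b ψ s) : a = b :=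
  Subtype.ext (ContinuousLinearMap.ext fun ψ => lp.ext (funext fun s => h ψ s))

theorem act_mul (a b : QuasiLocal E) (ψ : ConfigSpace E) : act (a * b) ψ = act a (b.1 ψ) := rfl

theorem act_add (a b : QuasiLocal E) (ψ : ConfigSpace E) (s : E → ZMod 2) :
    act (a + b) ψ s = act a ψ s + act b ψ s := rfl

theorem act_smul (c : ℂ) (a : QuasiLocal E) (ψ : ConfigSpace E) (s : E → ZMod 2) :
    act (c • a) ψ s = c * act a ψ s := rfl

theorem act_one (ψ : ConfigSpace E) (s : E → ZMod 2) :
    act (1 : QuasiLocal E) ψ s = amp ψ s := rfl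

theorem act_sum {ι : Type*} (F : Finset ι) (a : ι → QuasiLocal E) (ψ : ConfigSpace E)
    (s : E → ZMod 2) : act (∑ i ∈ F, a i) ψ s = ∑ i ∈ F, act (a i) ψ s := by
  classical
  induction F using Finset.induction_on with
  | empty => rfl
  | insert i F hi ih => rw [Finset.sum_insert hi, Finset.sum_insert hi, act_add, ih]

/-- `a` is `c` times the Pauli string `Z^z X^x`. -/
def IsPauli (c : ℂ) (x z : E →₀ ZMod 2) (a : QuasiLocal E) : Prop :=
  ∀ ψ s, act a ψ s = c * sgn (pair z s) * amp ψ (s + ⇑x)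

theorem IsPauli.ext {c : ℂ} {x z : E →₀ ZMod 2} {a b : QuasiLocal E} (ha : IsPauli c x z a)
    (hb : IsPauli c x z b) : a = b :=
  ext_act fun ψ s => by rw [ha, hb]

theorem IsPauli.smul {c : ℂ} {x z : E →₀ ZMod 2} {a : QuasiLocal E} (ha : IsPauli c x z a)
    (d : ℂ) : IsPauli (d * c) x z (d • a) := fun ψ s => by
  rw [act_smul, ha, mul_assoc, mul_assoc, mul_assoc]

/-- The sign is the cost of moving `X^x` past `Z^z'`. -/
theorem IsPauli.mul {c c' : ℂ} {x x' z z' : E →₀ ZMod 2} {a b : QuasiLocal E}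
    (ha : IsPauli c x z a) (hb : IsPauli c' x' z' b) :
    IsPauli (c * c' * sgn (pair z' x)) (x + x') (z + z') (a * b) := fun ψ s => by
  have hb' := hb ψ (s + ⇑x)
  rw [act_mul, ha]
  change c * sgn (pair z s) * act b ψ (s + ⇑x) = _
  rw [hb', pair_add_right, pair_add_left, sgn_add, sgn_add, Finsupp.coe_add, add_assoc]
  ring

theorem isPauli_one : IsPauli 1 0 0 (1 : QuasiLocal E) := fun ψ s => by
  rw [act_one, pair_zero_left, sgn_zero, Finsupp.coe_zero, add_zero, mul_one, one_mul]

/-- The two orders of multiplication carry the signs of `z'·x` and `z·x'`, whose ratio is the sign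
of the symplectic form. -/
theorem IsPauli.mul_eq {c c' : ℂ} {x x' z z' : E →₀ ZMod 2} {a b : QuasiLocal E}
    (ha : IsPauli c x z a) (hb : IsPauli c' x' z' b) :
    a * b = sgn (pair z' x + pair z x') • (b * a) := by
  refine (ha.mul hb).ext ?_
  have h := (hb.mul ha).smul (sgn (pair z' x + pair z x'))
  rw [add_comm x' x, add_comm z' z] at h
  convert h using 1
  have h2 : sgn (pair z x') * sgn (pair z x') = 1 := by
    unfold sgn
    split_ifs <;> simp
  rw [sgn_add]
  linear_combination (-c * c' * sgn (pair z' x)) * h2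

/-- Products of Pauli strings from a given family. -/
theorem exists_isPauli_linearCombination {ι : Type*} {S : ι → QuasiLocal E}
    {ξ ζ : ι → E →₀ ZMod 2} (hS : ∀ i, IsPauli 1 (ξ i) (ζ i) (S i))
    (B : Subalgebra ℂ (QuasiLocal E)) (hB : ∀ i, S i ∈ B) (g : ι →₀ ZMod 2) :
    ∃ a ∈ B, ∃ c ≠ 0, IsPauli c (Finsupp.linearCombination (ZMod 2) ξ g)
      (Finsupp.linearCombination (ZMod 2) ζ g) a := by
  induction g using Finsupp.induction_linear with
  | zero => exact ⟨1, one_mem _, 1, one_ne_zero, by simpa using isPauli_one⟩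
  | add f g hf hg =>
    obtain ⟨a, ha, c, hc, h⟩ := hf
    obtain ⟨b, hb, d, hd, h'⟩ := hg
    exact ⟨a * b, mul_mem ha hb, _, mul_ne_zero (mul_ne_zero hc hd) (sgn_ne_zero _), by
      rw [map_add, map_add]
      exact h.mul h'⟩
  | single i k =>
    rcases eq_zero_or_one k with rfl | rfl
    · exact ⟨1, one_mem _, 1, one_ne_zero, by simpa using isPauli_one⟩
    · exact ⟨S i, hB i, 1, one_ne_zero, by simpa using hS i⟩

theorem siteOp_apply (e : E) (m : Matrix (Fin 2) (Fin 2) ℂ) (ψ : ConfigSpace E) (s : E → ZMod 2) :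
    act (siteOp e m) ψ s =
      ∑ k : Fin 2, m (toConfig s e) k * amp ψ (Function.update s e k) := by
  change localOp {e} _ ψ (toConfig s) = _
  rw [localOp_apply]
  refine Fintype.sum_equiv (Equiv.funUnique ({e} : Finset E) (Fin 2)) _ _ fun t => ?_
  have : patch {e} (toConfig s) t = toConfig (Function.update s e (t default)) := by
    funext e'
    by_cases h : e' = e
    · subst h
      simp [patch, toConfig, Function.update]
      rfl
    · simp [patch, toConfig, h, Function.update]
      rfl
  rw [this]
  rfl

theorem isPauli_sigmaX (e : E) : IsPauli 1 (Finsupp.single e 1) 0 (sigmaX e) := fun ψ s => by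
  rw [pair_zero_left, sgn_zero, one_mul, one_mul, sigmaX, siteOp_apply, Fin.sum_univ_two]
  have h : s + (Finsupp.single e 1 : E →₀ ZMod 2) = Function.update s e (s e + 1) := by
    funext e'
    by_cases h : e' = e
    · subst h; simp
    · simp [h]
  rw [h, show toConfig s e = s e from rfl]
  rcases eq_zero_or_one (s e) with hk | hk <;> rw [hk]
  · change (0 : ℂ) * _ + 1 * _ = _
    rw [zero_mul, zero_add, one_mul]
    rfl
  · change (1 : ℂ) * _ + 0 * _ = _
    rw [zero_mul, add_zero, one_mul]
    rfl

theorem isPauli_sigmaZ (e : E) : IsPauli 1 0 (Finsupp.single e 1) (sigmaZ e) := fun ψ s => by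
  rw [pair_single, one_mul, one_mul, sigmaZ, siteOp_apply, Fin.sum_univ_two, Finsupp.coe_zero,
    add_zero]
  have h : s = Function.update s e (s e) := by simp
  conv_rhs => rw [h]
  rw [show toConfig s e = s e from rfl]
  rcases eq_zero_or_one (s e) with hk | hk <;> rw [hk]
  · change (1 : ℂ) * _ + 0 * _ = _
    rw [zero_mul, add_zero]
    simp [sgn_zero]
    rfl
  · change (0 : ℂ) * _ + (-1) * _ = _
    rw [zero_mul, zero_add]
    simp [sgn_one]
    rfl

theorem star_siteOp (e : E) (m : Matrix (Fin 2) (Fin 2) ℂ) :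
    star (siteOp e m) = siteOp e (star m) := by
  refine Subtype.ext ?_
  change star (localEmbed {e} _) = localEmbed {e} _
  rw [← map_star]
  rfl

theorem star_sigmaX (e : E) : star (sigmaX e) = sigmaX e := by
  rw [sigmaX, star_siteOp]
  congr 1
  ext i j
  fin_cases i <;> fin_cases j <;> simp [Matrix.star_apply]

theorem star_sigmaZ (e : E) : star (sigmaZ e) = sigmaZ e := by
  rw [sigmaZ, star_siteOp]
  congr 1
  ext i j
  fin_cases i <;> fin_cases j <;> simp [Matrix.star_apply]

variable (E) in
/-- The algebra generated by the Pauli matrices of the sites. -/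
def pauliAlgebra : Subalgebra ℂ (QuasiLocal E) :=
  Algebra.adjoin ℂ (Set.range sigmaX ∪ Set.range sigmaZ)

theorem sigmaX_mem_pauliAlgebra (e : E) : sigmaX e ∈ pauliAlgebra E :=
  Algebra.subset_adjoin (Or.inl ⟨e, rfl⟩)

theorem sigmaZ_mem_pauliAlgebra (e : E) : sigmaZ e ∈ pauliAlgebra E :=
  Algebra.subset_adjoin (Or.inr ⟨e, rfl⟩)

theorem exists_isPauli_x (x : E →₀ ZMod 2) : ∃ a ∈ pauliAlgebra E, ∃ c ≠ 0, IsPauli c x 0 a := by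
  have h := exists_isPauli_linearCombination isPauli_sigmaX (pauliAlgebra E)
    sigmaX_mem_pauliAlgebra x
  rw [linearCombination_single] at h
  simpa [Finsupp.linearCombination_apply] using h

theorem exists_isPauli_z (z : E →₀ ZMod 2) : ∃ a ∈ pauliAlgebra E, ∃ c ≠ 0, IsPauli c 0 z a := by
  have h := exists_isPauli_linearCombination isPauli_sigmaZ (pauliAlgebra E)
    sigmaZ_mem_pauliAlgebra z
  rw [linearCombination_single] at h
  simpa [Finsupp.linearCombination_apply] using h

/-- The projection onto the configurations that agree with `r` on `Λ`. -/
theorem exists_cylinder (Λ : Finset E) (r : E → ZMod 2) :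
    ∃ a ∈ pauliAlgebra E, ∀ ψ s,
      act a ψ s = if ∀ e ∈ Λ, s e = r e then amp ψ s else 0 := by
  induction Λ using Finset.induction_on with
  | empty => exact ⟨1, one_mem _, fun ψ s => by simp [act_one]⟩
  | insert e Λ he ih =>
    obtain ⟨a, ha, h⟩ := ih
    -- The new factor is the spectral projection of `σ^z` at `e` that selects the bit `r e`.
    refine ⟨((2⁻¹ : ℂ) • (1 + sgn (r e) • sigmaZ e)) * a, mul_mem (Subalgebra.smul_mem _ (add_mem
      (one_mem _) (Subalgebra.smul_mem _ (sigmaZ_mem_pauliAlgebra e) _)) _) ha, fun ψ s => ?_⟩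
    have h' := h ψ s
    rw [act_mul, act_smul, act_add, act_smul, act_one, isPauli_sigmaZ e, Finsupp.coe_zero, add_zero,
      pair_single, one_mul, one_mul]
    change (2⁻¹ : ℂ) * (act a ψ s + sgn (r e) * (sgn (s e) * act a ψ s)) = _
    rw [h']
    simp only [Finset.forall_mem_insert]
    by_cases hs : ∀ e ∈ Λ, s e = r e
    · rw [if_pos hs]
      have key : ∀ k l : ZMod 2, sgn k * sgn l = if l = k then 1 else -1 := by
        intro k l
        rw [← sgn_add, sgn]
        congr 1
        revert k l
        decide
      by_cases hse : s e = r e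
      · rw [if_pos ⟨hse, hs⟩]
        have := key (r e) (s e)
        rw [if_pos hse] at this
        linear_combination (2⁻¹ : ℂ) * amp ψ s * this
      · rw [if_neg fun h => hse h.1]
        have := key (r e) (s e)
        rw [if_neg hse] at this
        linear_combination (2⁻¹ : ℂ) * amp ψ s * this
    · rw [if_neg hs, if_neg fun h => hs h.2]
      simp

/-- An element of `𝒜_Λ` as an element of the quasi-local algebra. -/
def localElt (Λ : Finset E) : LocalMatrix Λ →⋆ₐ[ℂ] QuasiLocal E :=
  (localEmbed Λ).codRestrict (quasiLocal E) (localEmbed_mem Λ)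

/-- A matrix is the sum of its entries times (diagonal projection onto a row) times (bit flip by the
displacement from row to column). Both factors are polynomials in Pauli matrices; `(c u)⁻¹`
normalizes the flip. -/
theorem localElt_mem_pauliAlgebra (Λ : Finset E) (m : LocalMatrix Λ) :
    localElt Λ m ∈ pauliAlgebra E := by
  choose D hD hD' using fun r : Λ → Fin 2 => exists_cylinder Λ (ofConfig (patch Λ 0 r))
  choose X hX c hc hX' using fun u : Λ → Fin 2 => exists_isPauli_x
    (Finsupp.onFinset Λ (ofConfig (patch Λ 0 u)) fun e he => by
      by_contra h
      exact he (by simp [ofConfig, patch, h]; rfl))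
  have key : localElt Λ m = ∑ r, ∑ u, (m r (r + u) * (c u)⁻¹) • (D r * X u) := by
    refine ext_act fun ψ s => ?_
    have hl : act (localElt Λ m) ψ s = _ := localFun_eq Λ m ψ (toConfig s)
    refine hl.trans (Eq.symm ?_)
    rw [act_sum]
    refine (Finset.sum_eq_single (restr Λ (toConfig s)) ?_ ?_).trans ?_
    · intro r _ hr
      rw [act_sum]
      refine Finset.sum_eq_zero fun u _ => ?_
      rw [act_smul, act_mul, hD', if_neg, mul_zero]
      intro h
      refine hr (funext fun e => ?_)
      rw [restr, toConfig, h e e.2]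
      simp [ofConfig, patch]
    · simp
    · rw [act_sum]
      refine Finset.sum_congr rfl fun u _ => ?_
      rw [act_smul, act_mul, hD', if_pos]
      · have h := hX' u ψ s
        change _ * act (X u) ψ s = _
        rw [h, pair_zero_left, sgn_zero, mul_one, mul_assoc, inv_mul_cancel_left₀ (hc u)]
        rfl
      · intro e he
        simp [ofConfig, toConfig, patch, he, restr]
  rw [key]
  exact Subalgebra.sum_mem _ fun r _ => Subalgebra.sum_mem _ fun u _ =>
    Subalgebra.smul_mem _ (mul_mem (hD r) (hX u)) _

theorem range_localEmbed_mono {Λ Λ' : Finset E} (h : Λ ⊆ Λ') :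
    (localEmbed Λ).range ≤ (localEmbed Λ').range := by
  rintro _ ⟨a, rfl⟩
  exact ⟨extendMatrix h a, localEmbed_extendMatrix h a⟩

/-- The ranges form a directed family, so their supremum is the plain union. -/
theorem mem_localAlgebra {T : ConfigSpace E →L[ℂ] ConfigSpace E} :
    T ∈ localAlgebra E ↔ ∃ (Λ : Finset E) (m : LocalMatrix Λ), localEmbed Λ m = T := by
  have h := StarSubalgebra.coe_iSup_of_directed (S := fun Λ : Finset E => (localEmbed Λ).range)
    (fun Λ Λ' => ⟨Λ ∪ Λ', range_localEmbed_mono Finset.subset_union_left,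
      range_localEmbed_mono Finset.subset_union_right⟩)
  rw [← SetLike.mem_coe, localAlgebra, h, Set.mem_iUnion]
  rfl

/-- The local observables are dense. -/
theorem dense_localElt : Dense {a : QuasiLocal E | ∃ Λ m, localElt Λ m = a} := by
  intro a
  rw [closure_subtype]
  have ha : a.1 ∈ closure (localAlgebra E : Set (ConfigSpace E →L[ℂ] ConfigSpace E)) := by
    rw [← StarSubalgebra.topologicalClosure_coe]
    exact a.2
  refine closure_mono ?_ ha
  intro T hT
  obtain ⟨Λ, m, rfl⟩ := mem_localAlgebra.1 hT
  exact ⟨localElt Λ m, ⟨Λ, m, rfl⟩, rfl⟩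

theorem dense_pauliAlgebra : Dense (pauliAlgebra E : Set (QuasiLocal E)) :=
  by
  refine dense_localElt.mono ?_
  rintro _ ⟨Λ, m, rfl⟩
  exact localElt_mem_pauliAlgebra Λ m

/-- Induction over the linear span of the Pauli strings. -/
theorem pauliAlgebra_induction {p : QuasiLocal E → Prop}
    (pauli : ∀ c x z a, IsPauli c x z a → p a) (add : ∀ a b, p a → p b → p (a + b))
    (smul : ∀ (c : ℂ) a, p a → p (c • a)) {a : QuasiLocal E} (ha : a ∈ pauliAlgebra E) : p a := by
  -- Multiples of strings are closed under products, so the generated algebra is contained in their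
  -- linear span.
  let M : Submonoid (QuasiLocal E) :=
    { carrier := {a | ∃ c x z, IsPauli c x z a}
      one_mem' := ⟨_, _, _, isPauli_one⟩
      mul_mem' := fun ⟨_, _, _, h⟩ ⟨_, _, _, h'⟩ => ⟨_, _, _, h.mul h'⟩ }
  have hM : Submonoid.closure (Set.range sigmaX ∪ Set.range sigmaZ) ≤ M := by
    rw [Submonoid.closure_le]
    rintro _ (⟨e, rfl⟩ | ⟨e, rfl⟩)
    · exact ⟨_, _, _, isPauli_sigmaX e⟩
    · exact ⟨_, _, _, isPauli_sigmaZ e⟩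
  have h : a ∈ Submodule.span ℂ (M : Set (QuasiLocal E)) := by
    have ha' : a ∈ Subalgebra.toSubmodule (pauliAlgebra E) := ha
    rw [pauliAlgebra, Algebra.adjoin_eq_span] at ha'
    exact Submodule.span_mono hM ha'
  clear ha
  induction h using Submodule.span_induction with
  | mem a h =>
    obtain ⟨c, x, z, h⟩ := h
    exact pauli _ _ _ _ h
  | zero => exact pauli 0 0 0 0 fun ψ s => by rw [zero_mul, zero_mul]; rfl
  | add a b _ _ ha hb => exact add _ _ ha hb
  | smul c a _ ha => exact smul _ _ ha

end SpinSystem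

/-! ### Planar homology mod 2 -/

namespace ToricCode

open SpinSystem CStarDiagonal

/-- A compactly supported mod 2 cycle on the square lattice is the boundary of a compactly
supported chain of faces. -/
theorem exists_boundary {h v : ℤ → ℤ → ZMod 2} {N : ℤ}
    (hh : ∀ i j, N < |i| ∨ N < |j| → h i j = 0) (hv : ∀ i j, N < |i| ∨ N < |j| → v i j = 0)
    (hcycle : ∀ i j, h i j + v i j + h (i - 1) j + v i (j - 1) = 0) :
    ∃ g : ℤ → ℤ → ZMod 2, (∀ i j, h i j = g i j + g i (j - 1)) ∧
      (∀ i j, v i j = g i j + g (i - 1) j) ∧ ∀ i j, N < |i| ∨ N < |j| → g i j = 0 := by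
  have h2 : (2 : ZMod 2) = 0 := by decide
  -- `g i j` is the parity of the horizontal edges crossed on the way straight down from the face
  -- `(i, j)`, a winding number mod 2.
  set g : ℤ → ℤ → ZMod 2 := fun i j => ∑ k ∈ Finset.Icc (-N) N, if k ≤ j then h i k else 0 with hg
  have g1 : ∀ i j, h i j = g i j + g i (j - 1) := by
    intro i j
    rw [hg]
    dsimp only
    rw [← Finset.sum_add_distrib]
    have : ∀ k ∈ Finset.Icc (-N) N, ((if k ≤ j then h i k else 0) +
        if k ≤ j - 1 then h i k else 0) = if k = j then h i k else 0 := by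
      intro k _
      rcases lt_trichotomy k j with hk | hk | hk
      · rw [if_pos hk.le, if_pos (by omega), if_neg hk.ne]
        linear_combination h i k * h2
      · rw [if_pos hk.le, if_neg (by omega), if_pos hk, add_zero]
      · rw [if_neg (by omega), if_neg (by omega), if_neg hk.ne', add_zero]
    rw [Finset.sum_congr rfl this, Finset.sum_ite_eq']
    split_ifs with hj
    · rfl
    · exact hh i j (Or.inr (by
        rw [Finset.mem_Icc, ← abs_le] at hj
        omega))
  have glow : ∀ i j, j < -N → g i j = 0 := fun i j hj =>
    Finset.sum_eq_zero fun k hk => if_neg (by have := Finset.mem_Icc.1 hk; omega)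
  have gside : ∀ i j, N < |i| → g i j = 0 := fun i j hi =>
    Finset.sum_eq_zero fun k _ => by rw [hh i k (Or.inl hi), ite_self]
  -- Induction upwards in `j`: below the support all terms vanish, and the cycle condition at `(i,
  -- j)` carries the identity from `j - 1` to `j`.
  have g2 : ∀ i j, v i j = g i j + g (i - 1) j := by
    intro i j
    have low : ∀ j, j < -N → v i j = g i j + g (i - 1) j := fun j hj => by
      rw [glow _ _ hj, glow _ _ hj, add_zero]
      exact hv i j (Or.inr (lt_abs.2 (Or.inr (by omega))))
    rcases lt_or_ge j (-N) with hj | hj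
    · exact low j hj
    · have step : ∀ j, v i (j - 1) = g i (j - 1) + g (i - 1) (j - 1) →
          v i j = g i j + g (i - 1) j := fun j ih => by
        have e := hcycle i j
        rw [g1 i j, g1 (i - 1) j, ih] at e
        linear_combination e - (g i j + g i (j - 1) + g (i - 1) (j - 1) + g (i - 1) j) * h2
      induction j, hj using Int.leInduction with
      | base => exact step _ (low _ (by omega))
      | succ j _ ih => exact step _ (by rwa [add_sub_cancel_right])
  refine ⟨g, g1, g2, fun i j hij => ?_⟩
  rcases hij with hi | hj
  · exact gside i j hi
  -- Above the support there are no vertical edges, so by `g2` a row of `g` is constant, and it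
  -- vanishes on the far left.
  · rcases lt_abs.1 hj with hj' | hj'
    · rcases lt_or_ge i (-N) with hi | hi
      · exact gside i j (lt_abs.2 (Or.inr (by omega)))
      · have step : ∀ i, g (i - 1) j = 0 → g i j = 0 := fun i ih => by
          have e := g2 i j
          rw [ih, add_zero, hv i j (Or.inr hj)] at e
          exact e.symm
        induction i, hi using Int.leInduction with
        | base => exact step _ (gside _ _ (lt_abs.2 (Or.inr (by omega))))
        | succ i _ ih => exact step _ (by rwa [add_sub_cancel_right])
    · exact glow i j (by omega)

/-- The edges of the star of `v`. -/
def starVec (v : Vertex) : Edge →₀ ZMod 2 :=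
  .single (hEdge v) 1 + .single (vEdge v) 1 + .single (hEdge (v - (1, 0))) 1 +
    .single (vEdge (v - (0, 1))) 1

/-- The edges of the boundary of `p`. -/
def faceVec (p : Face) : Edge →₀ ZMod 2 :=
  .single (hEdge p) 1 + .single (vEdge p) 1 + .single (hEdge (p + (0, 1))) 1 +
    .single (vEdge (p + (1, 0))) 1

theorem pair_starVec (v : Vertex) (s : Edge → ZMod 2) :
    pair (starVec v) s =
      s (hEdge v) + s (vEdge v) + s (hEdge (v - (1, 0))) + s (vEdge (v - (0, 1))) := by
  simp only [starVec, pair_add_left, pair_single, one_mul]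

theorem pair_faceVec (p : Face) (s : Edge → ZMod 2) :
    pair (faceVec p) s =
      s (hEdge p) + s (vEdge p) + s (hEdge (p + (0, 1))) + s (vEdge (p + (1, 0))) := by
  simp only [faceVec, pair_add_left, pair_single, one_mul]

theorem hEdge_inj {v v' : Vertex} : hEdge v = hEdge v' ↔ v = v' := by simp [hEdge]

theorem vEdge_inj {v v' : Vertex} : vEdge v = vEdge v' ↔ v = v' := by simp [vEdge]

theorem hEdge_ne_vEdge (v v' : Vertex) : hEdge v ≠ vEdge v' := by simp [hEdge, vEdge]

theorem edge_cases (e : Edge) : (∃ v, e = hEdge v) ∨ ∃ v, e = vEdge v := by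
  obtain ⟨v, b⟩ := e
  cases b
  · exact Or.inl ⟨v, rfl⟩
  · exact Or.inr ⟨v, rfl⟩

theorem faceVec_hEdge (p : Face) (v : Vertex) :
    faceVec p (hEdge v) = (if p = v then 1 else 0) + if p = v - (0, 1) then 1 else 0 := by
  simp [faceVec, Finsupp.single_apply, hEdge_inj, (hEdge_ne_vEdge _ _).symm, eq_sub_iff_add_eq]

theorem faceVec_vEdge (p : Face) (v : Vertex) :
    faceVec p (vEdge v) = (if p = v then 1 else 0) + if p = v - (1, 0) then 1 else 0 := by
  simp [faceVec, Finsupp.single_apply, vEdge_inj, hEdge_ne_vEdge, eq_sub_iff_add_eq]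

theorem starVec_hEdge (p : Vertex) (v : Vertex) :
    starVec p (hEdge v) = (if p = v then 1 else 0) + if p = v + (1, 0) then 1 else 0 := by
  simp [starVec, Finsupp.single_apply, hEdge_inj, (hEdge_ne_vEdge _ _).symm, sub_eq_iff_eq_add]

theorem starVec_vEdge (p : Vertex) (v : Vertex) :
    starVec p (vEdge v) = (if p = v then 1 else 0) + if p = v + (0, 1) then 1 else 0 := by
  simp [starVec, Finsupp.single_apply, vEdge_inj, hEdge_ne_vEdge, sub_eq_iff_eq_add]

/-- Every edge borders two faces and joins two vertices, so both incidence maps have this form. -/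
theorem linearCombination_apply_of_eq {ι E : Type*} [DecidableEq ι] {ζ : ι → E →₀ ZMod 2} {e : E}
    {i j : ι} (h : ∀ p, ζ p e = (if p = i then 1 else 0) + if p = j then 1 else 0)
    (g : ι →₀ ZMod 2) : Finsupp.linearCombination (ZMod 2) ζ g e = g i + g j := by
  induction g using Finsupp.induction_linear with
  | zero => simp
  | add f g hf hg => rw [map_add, Finsupp.add_apply, hf, hg]; simp only [Finsupp.add_apply]; ring
  | single p k =>
    rw [Finsupp.linearCombination_single, Finsupp.smul_apply, h, Finsupp.single_apply,
      Finsupp.single_apply, smul_eq_mul, mul_add, mul_ite, mul_ite, mul_one, mul_zero]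

theorem exists_bound (x : Edge →₀ ZMod 2) :
    ∃ N : ℤ, ∀ v b, N < |v.1| ∨ N < |v.2| → x (v, b) = 0 := by
  -- A crude bound: the sum of all coordinates over the support, in absolute value.
  refine ⟨∑ e ∈ x.support, (|e.1.1| + |e.1.2|), fun v b hv => ?_⟩
  by_contra hx
  have h := Finset.single_le_sum (f := fun e : Edge => |e.1.1| + |e.1.2|)
    (fun e _ => add_nonneg (abs_nonneg _) (abs_nonneg _)) (Finsupp.mem_support_iff.2 hx)
  have h1 := abs_nonneg v.1
  have h2 := abs_nonneg v.2
  dsimp only at h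
  omega

theorem exists_finsupp {g : ℤ → ℤ → ZMod 2} {N : ℤ} (hg : ∀ i j, N < |i| ∨ N < |j| → g i j = 0) :
    ∃ G : ℤ × ℤ →₀ ZMod 2, ∀ v, G v = g v.1 v.2 :=
  ⟨Finsupp.onFinset (Finset.Icc (-N) N ×ˢ Finset.Icc (-N) N) (fun v => g v.1 v.2) fun v hv => by
    simp only [Finset.mem_product, Finset.mem_Icc, ← abs_le]
    by_contra h
    rw [not_and_or, not_le, not_le] at h
    exact hv (hg _ _ h), fun v => rfl⟩

theorem exists_faces {z : Edge →₀ ZMod 2} (hz : ∀ v, pair (starVec v) z = 0) :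
    ∃ g, Finsupp.linearCombination (ZMod 2) faceVec g = z := by
  obtain ⟨N, hN⟩ := exists_bound z
  obtain ⟨g, g1, g2, g3⟩ := exists_boundary (h := fun i j => z (hEdge (i, j)))
    (v := fun i j => z (vEdge (i, j))) (fun i j h => hN (i, j) _ h) (fun i j h => hN (i, j) _ h)
    (fun i j => by simpa [pair_starVec] using hz (i, j))
  obtain ⟨G, hG⟩ := exists_finsupp g3
  refine ⟨G, Finsupp.ext fun e => ?_⟩
  obtain ⟨⟨i, j⟩, rfl⟩ | ⟨⟨i, j⟩, rfl⟩ := edge_cases e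
  · rw [linearCombination_apply_of_eq fun p => faceVec_hEdge p _, hG, hG, g1]
    simp
  · rw [linearCombination_apply_of_eq fun p => faceVec_vEdge p _, hG, hG, g2]
    simp

/-- Lattice duality: the half turn `(i, j) ↦ (-i, -j)`, with horizontal and vertical edges
exchanged, turns the face condition into the cycle condition at vertices. -/
theorem exists_vertices {x : Edge →₀ ZMod 2} (hx : ∀ p, pair (faceVec p) x = 0) :
    ∃ g, Finsupp.linearCombination (ZMod 2) starVec g = x := by
  obtain ⟨N, hN⟩ := exists_bound x
  obtain ⟨g, g1, g2, g3⟩ := exists_boundary (h := fun i j => x (vEdge (-i, -j)))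
    (v := fun i j => x (hEdge (-i, -j))) (N := N)
    (fun i j h => hN (-i, -j) _ (by simpa using h)) (fun i j h => hN (-i, -j) _ (by simpa using h))
    (fun i j => by
      have h := hx (-i, -j)
      rw [pair_faceVec] at h
      simp only [Prod.mk_add_mk, add_zero] at h
      rw [show -(i - 1) = -i + 1 by ring, show -(j - 1) = -j + 1 by ring]
      linear_combination h)
  obtain ⟨G, hG⟩ := exists_finsupp (g := fun i j => g (-i) (-j)) (N := N)
    (fun i j h => g3 _ _ (by simpa using h))
  refine ⟨G, Finsupp.ext fun e => ?_⟩
  obtain ⟨⟨i, j⟩, rfl⟩ | ⟨⟨i, j⟩, rfl⟩ := edge_cases e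
  · rw [linearCombination_apply_of_eq fun p => starVec_hEdge p _, hG, hG]
    have h := g2 (-i) (-j)
    rw [neg_neg, neg_neg] at h
    rw [h]
    simp only [Prod.mk_add_mk, add_zero]
    rw [show -(i + 1) = -i - 1 by ring]
  · rw [linearCombination_apply_of_eq fun p => starVec_vEdge p _, hG, hG]
    have h := g1 (-i) (-j)
    rw [neg_neg, neg_neg] at h
    rw [h]
    simp only [Prod.mk_add_mk, add_zero]
    rw [show -(j + 1) = -j - 1 by ring]

/-! ### Stabilizers as Pauli strings, and the dichotomy -/

theorem isPauli_starOp (v : Vertex) : IsPauli 1 (starVec v) 0 (starOp v) := by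
  have h := (((isPauli_sigmaX (hEdge v)).mul (isPauli_sigmaX (vEdge v))).mul
    (isPauli_sigmaX (hEdge (v - (1, 0))))).mul (isPauli_sigmaX (vEdge (v - (0, 1))))
  simp only [pair_zero_left, sgn_zero, mul_one, add_zero] at h
  exact h

theorem isPauli_faceOp (p : Face) : IsPauli 1 0 (faceVec p) (faceOp p) := by
  have h := (((isPauli_sigmaZ (hEdge p)).mul (isPauli_sigmaZ (vEdge p))).mul
    (isPauli_sigmaZ (hEdge (p + (0, 1))))).mul (isPauli_sigmaZ (vEdge (p + (1, 0))))
  simp only [Finsupp.coe_zero, pair_zero_right, sgn_zero, mul_one, add_zero] at h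
  exact h

theorem star_starOp (v : Vertex) : star (starOp v) = starOp v := by
  refine IsPauli.ext (c := 1) (x := starVec v) (z := 0) ?_ (isPauli_starOp v)
  have h := (isPauli_sigmaX (vEdge (v - (0, 1)))).mul ((isPauli_sigmaX (hEdge (v - (1, 0)))).mul
    ((isPauli_sigmaX (vEdge v)).mul (isPauli_sigmaX (hEdge v))))
  simp only [starOp, star_mul, star_sigmaX]
  simp only [pair_zero_left, sgn_zero, mul_one, add_zero] at h
  convert h using 1
  rw [starVec]
  abel

theorem star_faceOp (p : Face) : star (faceOp p) = faceOp p := by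
  refine IsPauli.ext (c := 1) (x := 0) (z := faceVec p) ?_ (isPauli_faceOp p)
  have h := (isPauli_sigmaZ (vEdge (p + (1, 0)))).mul ((isPauli_sigmaZ (hEdge (p + (0, 1)))).mul
    ((isPauli_sigmaZ (vEdge p)).mul (isPauli_sigmaZ (hEdge p))))
  simp only [faceOp, star_mul, star_sigmaZ]
  simp only [Finsupp.coe_zero, pair_zero_right, sgn_zero, mul_one, add_zero] at h
  convert h using 1
  rw [faceVec]
  abel

/-- The edges on which the stabilizer of `w` acts by `σ^x`. -/
def xPart : Vertex ⊕ Face → Edge →₀ ZMod 2 := Sum.elim starVec 0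

/-- The edges on which the stabilizer of `w` acts by `σ^z`. -/
def zPart : Vertex ⊕ Face → Edge →₀ ZMod 2 := Sum.elim 0 faceVec

theorem isPauli_stabilizer (w : Vertex ⊕ Face) : IsPauli 1 (xPart w) (zPart w) (stabilizer w) :=
  match w with
  | .inl v => isPauli_starOp v
  | .inr p => isPauli_faceOp p

theorem star_stabilizer (w : Vertex ⊕ Face) : star (stabilizer w) = stabilizer w :=
  match w with
  | .inl v => star_starOp v
  | .inr p => star_faceOp p

/-- Each of the four faces around `v` contains two edges of its star, and any other face contains
none. -/
theorem pair_starVec_faceVec (v : Vertex) (p : Face) : pair (starVec v) (faceVec p) = 0 := by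
  rw [pair_starVec, faceVec_hEdge, faceVec_hEdge, faceVec_vEdge, faceVec_vEdge,
    show v - (1, 0) - (0, 1) = v - (0, 1) - (1, 0) from sub_right_comm _ _ _]
  have h2 : (2 : ZMod 2) = 0 := by decide
  linear_combination ((if p = v then 1 else 0) + (if p = v - (1, 0) then 1 else 0) +
    (if p = v - (0, 1) then 1 else 0) + (if p = v - (0, 1) - (1, 0) then 1 else 0)) * h2

theorem pair_zPart_xPart (w w' : Vertex ⊕ Face) : pair (zPart w) (xPart w') = 0 := by
  rcases w with v | p
  · exact pair_zero_left _
  rcases w' with v' | p'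
  · exact (pair_comm _ _).trans (pair_starVec_faceVec v' p)
  · exact pair_zero_right _

theorem stabilizer_mul_comm (w w' : Vertex ⊕ Face) :
    stabilizer w * stabilizer w' = stabilizer w' * stabilizer w := by
  rw [(isPauli_stabilizer w).mul_eq (isPauli_stabilizer w'), pair_zPart_xPart, pair_zPart_xPart,
    add_zero, sgn_zero, one_smul]

theorem stabilizer_mul_self (w : Vertex ⊕ Face) : stabilizer w * stabilizer w = 1 := by
  have h := (isPauli_stabilizer w).mul (isPauli_stabilizer w)
  have hself : ∀ y : Edge →₀ ZMod 2, y + y = 0 := fun y => Finsupp.ext fun e => by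
    rw [Finsupp.add_apply, Finsupp.zero_apply, CharTwo.add_self_eq_zero]
  rw [hself, hself, pair_zPart_xPart, sgn_zero, mul_one, mul_one] at h
  exact h.ext isPauli_one

/-- A Pauli string either is a multiple of a product of stabilizers, or anticommutes with some
stabilizer. -/
theorem mem_diagonal_or_anticomm {c : ℂ} {x z : Edge →₀ ZMod 2} {a : Algebra}
    (ha : IsPauli c x z a) :
    a ∈ diagonal ∨ ∃ w, stabilizer w * a = -(a * stabilizer w) := by
  by_cases h : ∀ w, pair z (xPart w) + pair (zPart w) x = 0
  · left
    -- Commuting with the stars makes `z` a cycle; commuting with the faces makes `x` a dual cycle.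
    obtain ⟨g, hg⟩ := exists_faces (z := z) fun v => by
      have := h (.inl v)
      rw [show zPart (.inl v) = 0 from rfl, pair_zero_left, add_zero] at this
      exact (pair_comm _ _).trans this
    obtain ⟨k, hk⟩ := exists_vertices (x := x) fun p => by
      have := h (.inr p)
      rwa [show xPart (.inr p) = 0 from rfl, Finsupp.coe_zero, pair_zero_right, zero_add] at this
    obtain ⟨b, hb, d, hd, hb'⟩ := exists_isPauli_linearCombination isPauli_starOp
      diagonal.toSubalgebra (fun v => stabilizer_mem (.inl v)) k
    obtain ⟨b₂, hb₂, d₂, hd₂, hb₂'⟩ := exists_isPauli_linearCombination isPauli_faceOp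
      diagonal.toSubalgebra (fun v => stabilizer_mem (.inr v)) g
    have h0 : ∀ (ι : Type) (g : ι →₀ ZMod 2),
        Finsupp.linearCombination (ZMod 2) (fun _ : ι => (0 : Edge →₀ ZMod 2)) g = 0 := by
      intro ι g
      simp [Finsupp.linearCombination_apply]
    rw [hk, h0] at hb'
    rw [hg, h0] at hb₂'
    have hm := hb'.mul hb₂'
    rw [add_zero, zero_add] at hm
    -- The product of stabilizers is the same string with coefficient `r` instead of `c`.
    set r := d * d₂ * sgn (pair z x) with hr
    have hr0 : r ≠ 0 := mul_ne_zero (mul_ne_zero hd hd₂) (sgn_ne_zero _)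
    have hs := hm.smul (c * r⁻¹)
    rw [inv_mul_cancel_right₀ hr0] at hs
    rw [ha.ext hs]
    exact diagonal.smul_mem (mul_mem hb hb₂) _
  · right
    push Not at h
    obtain ⟨w, hw⟩ := h
    refine ⟨w, ?_⟩
    rw [(isPauli_stabilizer w).mul_eq ha, (eq_zero_or_one _).resolve_left hw, sgn_one, neg_one_smul]

end ToricCode

/-! ### A state for every syndrome -/

namespace ToricCode

open SpinSystem CStarDiagonal Filter

/-- The configuration of a semi-infinite string of errors that starts at `w`. -/
theorem exists_string (w : Vertex ⊕ Face) : ∃ tx tz : Edge → ZMod 2,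
    ∀ w', pair (zPart w') tx + pair (xPart w') tz = if w' = w then 1 else 0 := by
  rcases w with v | p
  -- The horizontal edges on the ray to the right of `v`: only `v` meets an odd number of them, the
  -- other end being at infinity.
  · refine ⟨0, fun e => if e.2 = false ∧ e.1.2 = v.2 ∧ v.1 ≤ e.1.1 then 1 else 0, fun w' => ?_⟩
    rw [pair_zero_right, zero_add]
    rcases w' with v' | p'
    · rw [show xPart (.inl v') = starVec v' from rfl, pair_starVec]
      obtain ⟨a, b⟩ := v
      obtain ⟨a', b'⟩ := v'
      simp only [hEdge, vEdge, Prod.mk_sub_mk, Sum.inl.injEq, Prod.mk.injEq]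
      split_ifs <;> first | rfl | (exfalso; simp at * <;> omega)
    · rw [show xPart (.inr p') = 0 from rfl, pair_zero_left, if_neg (by simp)]
  -- The vertical edges crossed by a ray to the right from inside `p`; the first is the right side
  -- of `p`, hence the `+ 1`.
  · refine ⟨fun e => if e.2 = true ∧ e.1.2 = p.2 ∧ p.1 + 1 ≤ e.1.1 then 1 else 0, 0, fun w' => ?_⟩
    rw [pair_zero_right, add_zero]
    rcases w' with v' | p'
    · rw [show zPart (.inl v') = 0 from rfl, pair_zero_left, if_neg (by simp)]
    · rw [show zPart (.inr p') = faceVec p' from rfl, pair_faceVec]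
      obtain ⟨a, b⟩ := p
      obtain ⟨a', b'⟩ := p'
      simp only [hEdge, vEdge, Prod.mk_add_mk, Sum.inr.injEq, Prod.mk.injEq]
      split_ifs <;> first | rfl | (exfalso; simp at * <;> omega)

/-- An infinite string does not define an element of the algebra, but only its part in `Λ` matters
for strings supported there. -/
theorem exists_truncation (Λ : Finset Edge) (t : Edge → ZMod 2) :
    ∃ x : Edge →₀ ZMod 2, ∀ y : Edge →₀ ZMod 2, y.support ⊆ Λ → pair y x = pair y t := by
  refine ⟨Finsupp.onFinset Λ (fun e => if e ∈ Λ then t e else 0) fun e he => by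
    by_contra h
    exact he (if_neg h), fun y hy => ?_⟩
  simp only [pair, Finsupp.linearCombination_apply]
  refine Finset.sum_congr rfl fun e he => ?_
  simp only [Finsupp.onFinset_apply, if_pos (hy he)]

/-- A Pauli string that anticommutes with the stabilizer of `w`, and commutes with those of a given
finite set. -/
theorem exists_flip (F : Finset (Vertex ⊕ Face)) {w : Vertex ⊕ Face} (hw : w ∉ F) :
    ∃ (c : ℂ) (x z : Edge →₀ ZMod 2) (U : Algebra), c ≠ 0 ∧ IsPauli c x z U ∧
      stabilizer w * U = -(U * stabilizer w) ∧
      ∀ w' ∈ F, stabilizer w' * U = U * stabilizer w' := by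
  obtain ⟨tx, tz, ht⟩ := exists_string w
  set Λ := (insert w F).biUnion fun w => (xPart w).support ∪ (zPart w).support with hΛ
  obtain ⟨x, hx⟩ := exists_truncation Λ tx
  obtain ⟨z, hz⟩ := exists_truncation Λ tz
  have key : ∀ w' ∈ insert w F,
      pair z (xPart w') + pair (zPart w') x = if w' = w then 1 else 0 := fun w' h => by
    have hs := Finset.subset_biUnion_of_mem (fun w => (xPart w).support ∪ (zPart w).support) h
    rw [← ht w', pair_comm z, hx _ (Finset.subset_union_right.trans hs),
      hz _ (Finset.subset_union_left.trans hs), add_comm]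
  obtain ⟨a, -, c, hc, ha⟩ := exists_isPauli_x x
  obtain ⟨b, -, d, hd, hb⟩ := exists_isPauli_z z
  have hU := ha.mul hb
  rw [add_zero, zero_add] at hU
  refine ⟨_, x, z, a * b, mul_ne_zero (mul_ne_zero hc hd) (sgn_ne_zero _), hU, ?_, ?_⟩
  · rw [(isPauli_stabilizer w).mul_eq hU, key w (Finset.mem_insert_self _ _), if_pos rfl, sgn_one,
      neg_one_smul]
  · intro w' h
    rw [(isPauli_stabilizer w').mul_eq hU, key w' (Finset.mem_insert_of_mem h), if_neg, sgn_zero,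
      one_smul]
    rintro rfl
    exact hw h

theorem apply_ne_zero_of_isPauli {c : ℂ} {x z : Edge →₀ ZMod 2} {U : Algebra} (hc : c ≠ 0)
    (hU : IsPauli c x z U) {ψ : ConfigSpace Edge} (hψ : ψ ≠ 0) : U.1 ψ ≠ 0 := by
  intro h
  refine hψ (lp.ext (funext fun s => ?_))
  have h1 := hU ψ (ofConfig s - ⇑x)
  rw [sub_add_cancel, act, h] at h1
  have h2 : amp ψ (ofConfig s) = 0 :=
    (mul_eq_zero.1 h1.symm).resolve_left (mul_ne_zero hc (sgn_ne_zero _))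
  exact h2

theorem intUnit_mul_self (u : ℤˣ) : ((u : ℤ) : ℂ) * ((u : ℤ) : ℂ) = 1 := by
  rcases Int.units_eq_one_or u with rfl | rfl <;> simp

theorem star_intUnit (u : ℤˣ) : star ((u : ℤ) : ℂ) = ((u : ℤ) : ℂ) := by
  rcases Int.units_eq_one_or u with rfl | rfl <;> simp

/-- Every finite syndrome is realized by a vector. -/
theorem exists_eigenvector (f : Vertex ⊕ Face → ℤˣ) (F : Finset (Vertex ⊕ Face)) :
    ∃ ψ : ConfigSpace Edge, ψ ≠ 0 ∧ ∀ w ∈ F, (stabilizer w).1 ψ = ((f w : ℤ) : ℂ) • ψ := by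
  classical
  induction F using Finset.induction_on with
  | empty =>
    refine ⟨lp.single 2 0 1, fun h => ?_, by simp⟩
    have := congrArg (fun ψ : ConfigSpace Edge => ψ 0) h
    simp at this
  | insert w F hw ih =>
    obtain ⟨ψ, hψ, hF⟩ := ih
    set S := stabilizer w with hS
    set k := ((f w : ℤ) : ℂ) with hk
    have hkk : k * k = 1 := intUnit_mul_self _
    have hSS : ∀ φ : ConfigSpace Edge, S.1 (S.1 φ) = φ := fun φ =>
      congrArg (fun T : Algebra => T.1 φ) (stabilizer_mul_self w)
    -- Project `ψ` to the eigenspace `S = k`. If the result is zero, then `S ψ = -k ψ`, and a string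
    -- that flips only `w` among `insert w F` corrects the sign.
    by_cases h : ψ + k • S.1 ψ = 0
    · obtain ⟨c, x, z, U, hc, hU, hUw, hUF⟩ := exists_flip F hw
      refine ⟨U.1 ψ, apply_ne_zero_of_isPauli hc hU hψ, fun w' hw' => ?_⟩
      rcases Finset.mem_insert.1 hw' with rfl | hw'
      · have h1 : S.1 (U.1 ψ) = -(U.1 (S.1 ψ)) := congrArg (fun T : Algebra => T.1 ψ) hUw
        have h2 : S.1 ψ = -(k • ψ) := by
          have := congrArg (fun φ => k • φ) h
          simp only [smul_add, smul_smul, hkk, one_smul, smul_zero] at this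
          exact eq_neg_of_add_eq_zero_right this
        rw [h1, h2, map_neg, neg_neg, map_smul]
      · have h1 : (stabilizer w').1 (U.1 ψ) = U.1 ((stabilizer w').1 ψ) :=
          congrArg (fun T : Algebra => T.1 ψ) (hUF w' hw')
        rw [h1, hF w' hw', map_smul]
    · refine ⟨_, h, fun w' hw' => ?_⟩
      rcases Finset.mem_insert.1 hw' with rfl | hw'
      · rw [map_add, map_smul, hSS, smul_add, smul_smul, hkk, one_smul, add_comm]
      · have h1 : (stabilizer w').1 (S.1 ψ) = S.1 ((stabilizer w').1 ψ) :=
          congrArg (fun T : Algebra => T.1 ψ) (stabilizer_mul_comm w' w)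
        rw [map_add, map_smul, h1, hF w' hw', map_smul, smul_add, smul_comm]

/-- The vector functional `a ↦ ⟨ψ, a ψ⟩`. -/
def vectorFunctional (ψ : ConfigSpace Edge) : Algebra →L[ℂ] ℂ :=
  (innerSL ℂ ψ) ∘L (ContinuousLinearMap.apply ℂ (ConfigSpace Edge) ψ) ∘L
    (quasiLocal Edge).toSubalgebra.toSubmodule.subtypeL

theorem vectorFunctional_apply (ψ : ConfigSpace Edge) (a : Algebra) :
    vectorFunctional ψ a = inner ℂ ψ (a.1 ψ) := rfl

theorem norm_vectorFunctional_le {ψ : ConfigSpace Edge} (hψ : ‖ψ‖ = 1) :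
    ‖vectorFunctional ψ‖ ≤ 1 := by
  refine ContinuousLinearMap.opNorm_le_bound _ zero_le_one fun a => ?_
  rw [vectorFunctional_apply]
  refine (norm_inner_le_norm _ _).trans ?_
  rw [hψ, one_mul, one_mul]
  refine (a.1.le_opNorm ψ).trans ?_
  rw [hψ, mul_one]
  rfl

open scoped ComplexOrder in
theorem isState_vectorFunctional {ψ : ConfigSpace Edge} (hψ : ‖ψ‖ = 1) :
    IsState (vectorFunctional ψ) := by
  constructor
  · intro a
    have h : vectorFunctional ψ (star a * a) = inner ℂ (a.1 ψ) (a.1 ψ) := by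
      rw [vectorFunctional_apply]
      change inner ℂ ψ ((star a.1) (a.1 ψ)) = _
      rw [ContinuousLinearMap.star_eq_adjoint, ContinuousLinearMap.adjoint_inner_right]
    rw [h, inner_self_eq_norm_sq_to_K]
    have h2 := Complex.zero_le_real.2 (sq_nonneg ‖a.1 ψ‖)
    rw [Complex.ofReal_pow] at h2
    exact h2
  · change inner ℂ ψ ψ = 1
    rw [inner_self_eq_norm_sq_to_K, hψ]
    simp

open scoped ComplexOrder in
/-- Every syndrome is realized by a state. -/
theorem exists_state (f : Vertex ⊕ Face → ℤˣ) :
    ∃ η : Algebra →L[ℂ] ℂ, IsState η ∧ ∀ w, η (stabilizer w) = ((f w : ℤ) : ℂ) := by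
  classical
  have hex : ∀ F : Finset (Vertex ⊕ Face), ∃ ψ : ConfigSpace Edge, ‖ψ‖ = 1 ∧
      ∀ w ∈ F, (stabilizer w).1 ψ = ((f w : ℤ) : ℂ) • ψ := fun F => by
    obtain ⟨ψ, hψ, h⟩ := exists_eigenvector f F
    refine ⟨((‖ψ‖ : ℂ)⁻¹) • ψ, norm_smul_inv_norm (𝕜 := ℂ) hψ, fun w hw => ?_⟩
    rw [map_smul, h w hw, smul_comm]
  choose ψ hψ hψF using hex
  -- By Banach–Alaoglu the vector states converge weak-* along `u`. Each `w` lies in eventually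
  -- every `F`, so the limit has all the prescribed values.
  let u : Ultrafilter (Finset (Vertex ⊕ Face)) := Ultrafilter.of atTop
  let Φ : Finset (Vertex ⊕ Face) → WeakDual ℂ Algebra := fun F =>
    StrongDual.toWeakDual (vectorFunctional (ψ F))
  have hK := WeakDual.isCompact_closedBall (𝕜 := ℂ) (0 : StrongDual ℂ Algebra) 1
  obtain ⟨η, -, hη⟩ := hK.ultrafilter_le_nhds (u.map Φ) (by
      rw [le_principal_iff]
      refine Filter.mem_map.2 (Filter.univ_mem' fun F => ?_)
      change vectorFunctional (ψ F) ∈ Metric.closedBall (0 : StrongDual ℂ Algebra) 1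
      rw [mem_closedBall_zero_iff]
      exact norm_vectorFunctional_le (hψ F))
  have hlim : ∀ a : Algebra,
      Tendsto (fun F => vectorFunctional (ψ F) a) u (nhds (η a)) := fun a =>
    ((WeakDual.eval_continuous a).tendsto η).comp (show Tendsto Φ u (nhds η) from hη)
  refine ⟨WeakDual.toStrongDual η, ⟨fun a => ?_, ?_⟩, fun w => ?_⟩
  · exact ge_of_tendsto' (hlim _) fun F => (isState_vectorFunctional (hψ F)).1 a
  · exact tendsto_nhds_unique (hlim 1)
      (tendsto_const_nhds.congr fun F => ((isState_vectorFunctional (hψ F)).2).symm)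
  · refine tendsto_nhds_unique (hlim _) (tendsto_const_nhds.congr' ?_)
    have : ∀ᶠ F in (u : Filter (Finset (Vertex ⊕ Face))), w ∈ F :=
      (Ultrafilter.of_le atTop) (by
        filter_upwards [eventually_ge_atTop {w}] with F hF
        exact hF (Finset.mem_singleton_self w))
    filter_upwards [this] with F hF
    rw [vectorFunctional_apply, hψF F w hF, inner_smul_right, inner_self_eq_norm_sq_to_K, hψ]
    simp

end ToricCode

/-! ### Pure states of `𝒞` and their extensions -/

namespace ToricCode

open SpinSystem CStarDiagonal

theorem isClosed_diagonal : IsClosed (diagonal : Set Algebra) :=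
  StarSubalgebra.isClosed_topologicalClosure _

/-- Induction for closed predicates on the algebra generated by the stabilizers. -/
theorem diagonal_induction {p : diagonal → Prop} (closed : IsClosed {a | p a})
    (stab : ∀ w, p (stabilizerElt w)) (scalar : ∀ c : ℂ, p (algebraMap ℂ diagonal c))
    (add : ∀ a b, p a → p b → p (a + b)) (mul : ∀ a b, p a → p b → p (a * b)) (a : diagonal) :
    p a := by
  set B := StarAlgebra.adjoin ℂ (Set.range stabilizer) with hB
  have hle : B ≤ diagonal := StarSubalgebra.le_topologicalClosure _
  -- The generators are self-adjoint, so they generate the same algebra without adjoints and no case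
  -- for `star` is needed.
  have hstar : star (Set.range stabilizer) = Set.range stabilizer := by
    ext b
    constructor
    · rintro ⟨w, hw⟩
      exact ⟨w, by rw [← star_star b, ← hw, star_stabilizer]⟩
    · rintro ⟨w, rfl⟩
      exact ⟨w, (star_stabilizer w).symm⟩
  have hp : ∀ b (hb : b ∈ B), p ⟨b, hle hb⟩ := by
    intro b hb
    have hb' : b ∈ Algebra.adjoin ℂ (Set.range stabilizer) := by
      have : b ∈ B.toSubalgebra := hb
      rwa [hB, StarAlgebra.adjoin_toSubalgebra, hstar, Set.union_self] at this
    have hsub : Algebra.adjoin ℂ (Set.range stabilizer) ≤ diagonal.toSubalgebra :=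
      Algebra.adjoin_le (by
        rintro _ ⟨w, rfl⟩
        exact stabilizer_mem w)
    suffices h : ∀ h : b ∈ diagonal, p ⟨b, h⟩ from h _
    clear hb
    induction hb' using Algebra.adjoin_induction with
    | mem b h =>
      obtain ⟨w, rfl⟩ := h
      exact fun _ => stab w
    | algebraMap c => exact fun _ => scalar c
    | add b b' hb hb' ih ih' => exact fun _ => add _ _ (ih (hsub hb)) (ih' (hsub hb'))
    | mul b b' hb hb' ih ih' => exact fun _ => mul _ _ (ih (hsub hb)) (ih' (hsub hb'))
  have ha : a ∈ closure {b : diagonal | (b : Algebra) ∈ B} := by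
    rw [closure_subtype]
    have h : (a : Algebra) ∈ closure (B : Set Algebra) := by
      rw [← StarSubalgebra.topologicalClosure_coe]
      exact a.2
    refine closure_mono ?_ h
    intro b hb
    exact ⟨⟨b, hle hb⟩, hb, rfl⟩
  exact closure_minimal (t := {a | p a}) (fun b hb => hp b.1 hb) closed ha

theorem stabilizerElt_mul_self (w : Vertex ⊕ Face) : stabilizerElt w * stabilizerElt w = 1 :=
  Subtype.ext (stabilizer_mul_self w)

theorem star_stabilizerElt (w : Vertex ⊕ Face) : star (stabilizerElt w) = stabilizerElt w :=
  Subtype.ext (star_stabilizer w)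

/-- Whatever commutes with all stabilizers commutes with the algebra that they generate. -/
theorem commute_diagonal {a : Algebra} (ha : ∀ w, stabilizer w * a = a * stabilizer w)
    (b : diagonal) : b * a = a * b := by
  induction b using diagonal_induction with
  | closed => exact isClosed_eq (by fun_prop) (by fun_prop)
  | stab w => exact ha w
  | scalar c => exact Algebra.commutes c a
  | add b b' h h' =>
    rw [show ((b + b' : diagonal) : Algebra) = b + b' from rfl, add_mul, mul_add, h, h']
  | mul b b' h h' =>
    rw [show ((b * b' : diagonal) : Algebra) = b * b' from rfl, mul_assoc, h', ← mul_assoc, h,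
      mul_assoc]

theorem diagonal_mul_comm (a b : diagonal) : a * b = b * a :=
  Subtype.ext (commute_diagonal
    (fun w => (commute_diagonal (fun w' => stabilizer_mul_comm w' w) b).symm) a)

theorem IsEvaluation.eq {f : Vertex ⊕ Face → ℤˣ} {ω ω' : diagonal →L[ℂ] ℂ}
    (h : IsEvaluation f ω) (h' : IsEvaluation f ω') : ω = ω' := by
  ext a
  induction a using diagonal_induction with
  | closed => exact isClosed_eq ω.continuous ω'.continuous
  | stab w => rw [h.map_stabilizer, h'.map_stabilizer]
  | scalar c => rw [Algebra.algebraMap_eq_smul_one, map_smul, map_smul, h.map_one, h'.map_one]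
  | add a b ha hb => rw [map_add, map_add, ha, hb]
  | mul a b ha hb => rw [h.map_mul, h'.map_mul, ha, hb]

open scoped ComplexOrder in
-- The values on the self-adjoint generators are real, so `ω` preserves adjoints and `ω(a* a) =
-- |ω(a)|²`.
theorem IsEvaluation.isState {f : Vertex ⊕ Face → ℤˣ} {ω : diagonal →L[ℂ] ℂ}
    (h : IsEvaluation f ω) : IsState ω := by
  have hstar : ∀ a, ω (star a) = star (ω a) := fun a => by
    induction a using diagonal_induction with
    | closed => exact isClosed_eq (by fun_prop) (by fun_prop)
    | stab w => rw [star_stabilizerElt, h.map_stabilizer, star_intUnit]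
    | scalar c =>
      rw [Algebra.algebraMap_eq_smul_one, star_smul, star_one, map_smul, map_smul, h.map_one,
        smul_eq_mul, smul_eq_mul, mul_one, mul_one]
    | add a b ha hb => rw [star_add, map_add, map_add, star_add, ha, hb]
    | mul a b ha hb => rw [star_mul, h.map_mul, h.map_mul, star_mul, ha, hb]
  refine ⟨fun a => ?_, h.map_one⟩
  rw [h.map_mul, hstar]
  exact star_mul_self_nonneg _

/-- Each stabilizer lies in the multiplicative domain of `ω`, and the elements `a` with `ω(ab) =
ω(a)ω(b)` for all `b` form a closed subalgebra. -/
theorem isEvaluation_of_isState {f : Vertex ⊕ Face → ℤˣ} {ω : diagonal →L[ℂ] ℂ} (h : IsState ω)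
    (hf : ∀ w, ω (stabilizerElt w) = ((f w : ℤ) : ℂ)) : IsEvaluation f ω := by
  refine ⟨h.2, fun a => ?_, hf⟩
  induction a using diagonal_induction with
  | closed =>
    simp only [Set.ofPred_forall]
    exact isClosed_iInter fun b => isClosed_eq (by fun_prop) (by fun_prop)
  | stab w =>
    intro b
    rw [hf]
    exact (h.map_symmetry_mul (star_stabilizerElt w) (stabilizerElt_mul_self w) (star_intUnit _)
      (intUnit_mul_self _) (hf w) b).1
  | scalar c =>
    intro b
    rw [← Algebra.smul_def, Algebra.algebraMap_eq_smul_one, map_smul, map_smul, h.2, smul_eq_mul,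
      smul_eq_mul, mul_one]
  | add a a' ha ha' => intro b; rw [add_mul, map_add, map_add, ha, ha', add_mul]
  | mul a₁ a₂ h₁ h₂ =>
    intro b
    exact (congrArg ω (mul_assoc a₁ a₂ b)).trans ((h₁ _).trans ((congrArg _ (h₂ b)).trans
      ((mul_assoc _ _ _).symm.trans (congrArg (· * ω b) (h₁ a₂).symm))))

/-- The restriction of a functional to the algebra generated by the stabilizers. -/
def restrict (η : Algebra →L[ℂ] ℂ) : diagonal →L[ℂ] ℂ :=
  η ∘L diagonal.toSubalgebra.toSubmodule.subtypeL

theorem IsState.restrict {η : Algebra →L[ℂ] ℂ} (h : IsState η) : IsState (restrict η) :=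
  ⟨fun a => h.1 a, h.2⟩

theorem exists_isEvaluation (f : Vertex ⊕ Face → ℤˣ) :
    ∃ ω : diagonal →L[ℂ] ℂ, IsEvaluation f ω ∧ ∃ η : Algebra →L[ℂ] ℂ, IsState η ∧ Extends ω η := by
  obtain ⟨η, hη, hf⟩ := exists_state f
  exact ⟨restrict η, isEvaluation_of_isState (IsState.restrict hη) hf, η, hη, fun b => rfl⟩

/-- `±1` are extreme points of `[-1, 1]`, so a state in a convex decomposition of `ω` agrees with
`ω` on the stabilizers and is the same evaluation. -/
theorem IsEvaluation.isPureState {f : Vertex ⊕ Face → ℤˣ} {ω : diagonal →L[ℂ] ℂ}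
    (h : IsEvaluation f ω) : IsPureState ω := by
  refine ⟨h.isState, fun ω₁ h₁ ω₂ h₂ hseg => ?_⟩
  obtain ⟨s, t, hs, ht, hst, rfl⟩ := hseg
  refine (isEvaluation_of_isState h₁ fun w => ?_).eq h
  have hw := h.map_stabilizer w
  change (s : ℂ) * ω₁ (stabilizerElt w) + (t : ℂ) * ω₂ (stabilizerElt w) = _ at hw
  obtain ⟨him, hlo, hhi⟩ := IsState.map_symmetry_bound h₁ (star_stabilizerElt w)
    (stabilizerElt_mul_self w)
  obtain ⟨-, hlo', hhi'⟩ := IsState.map_symmetry_bound h₂ (star_stabilizerElt w)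
    (stabilizerElt_mul_self w)
  have hre := congrArg Complex.re hw
  simp only [Complex.add_re, Complex.re_ofReal_mul, Complex.intCast_re] at hre
  refine Complex.ext ?_ (by rw [him, Complex.intCast_im])
  rw [Complex.intCast_re]
  obtain rfl : s = 1 - t := by linarith
  rcases Int.units_eq_one_or (f w) with hfw | hfw <;> rw [hfw] at hre ⊢
  · simp only [Units.val_one, Int.cast_one] at hre ⊢
    nlinarith
  · simp only [Units.val_neg, Units.val_one, Int.cast_neg, Int.cast_one] at hre ⊢
    nlinarith

/-- `𝒞` is commutative, so the stabilizers are central symmetries in it and a pure state is `±1` on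
each. -/
theorem isPureState_iff (ω : diagonal →L[ℂ] ℂ) :
    IsPureState ω ↔ ∃ f : Vertex ⊕ Face → ℤˣ, IsEvaluation f ω := by
  refine ⟨fun h => ?_, fun ⟨f, h⟩ => h.isPureState⟩
  have : ∀ w, ∃ u : ℤˣ, ω (stabilizerElt w) = ((u : ℤ) : ℂ) := fun w => by
    rcases h.map_central_symmetry (star_stabilizerElt w) (stabilizerElt_mul_self w)
      (fun a => diagonal_mul_comm _ a) with h | h
    · exact ⟨1, by simpa using h⟩
    · exact ⟨-1, by simpa using h⟩
  choose f hf using this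
  exact ⟨f, isEvaluation_of_isState h.1 hf⟩

/-- A state that takes values `±1` on the stabilizers is determined by its values on them. -/
theorem IsEvaluation.extension_unique {f : Vertex ⊕ Face → ℤˣ} {ω : diagonal →L[ℂ] ℂ}
    (h : IsEvaluation f ω) {η η' : Algebra →L[ℂ] ℂ} (hη : IsState η) (hη' : IsState η')
    (e : Extends ω η) (e' : Extends ω η') : η = η' := by
  -- `f(w) η(a) = η(S_w a) = -η(a S_w) = -f(w) η(a)`.
  have zero : ∀ {η : Algebra →L[ℂ] ℂ}, IsState η → Extends ω η → ∀ {w a},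
      stabilizer w * a = -(a * stabilizer w) → η a = 0 := by
    intro η hη e w a hw
    obtain ⟨h1, h2⟩ := hη.map_symmetry_mul (star_stabilizer w) (stabilizer_mul_self w)
      (star_intUnit (f w)) (intUnit_mul_self _)
      ((e (stabilizerElt w)).trans (h.map_stabilizer w)) a
    rw [hw, map_neg, h2] at h1
    have h3 := intUnit_mul_self (f w)
    linear_combination (-η a) * h3 - (1 / 2 : ℂ) * ((f w : ℤ) : ℂ) * h1
  refine ContinuousLinearMap.ext fun a => ?_
  refine closure_minimal (s := (pauliAlgebra Edge : Set Algebra)) (t := {a | η a = η' a})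
    (fun a ha => ?_) (isClosed_eq η.continuous η'.continuous) (dense_pauliAlgebra a)
  refine pauliAlgebra_induction (p := fun a => η a = η' a) (fun c x z a ha => ?_)
    (fun a b ha hb => ?_) (fun c a ha => ?_) ha
  · rcases mem_diagonal_or_anticomm ha with h | ⟨w, hw⟩
    · exact (e ⟨a, h⟩).trans (e' ⟨a, h⟩).symm
    · exact (zero hη e hw).trans (zero hη' e' hw).symm
  · rw [map_add, map_add, ha, hb]
  · rw [map_smul, map_smul, ha]

/-- A convex decomposition of `η` restricts to one of the pure state `ω`, so its parts extend `ω`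
too and equal `η` by uniqueness. -/
theorem IsEvaluation.isPureState_extension {f : Vertex ⊕ Face → ℤˣ} {ω : diagonal →L[ℂ] ℂ}
    (h : IsEvaluation f ω) {η : Algebra →L[ℂ] ℂ} (hη : IsState η) (e : Extends ω η) :
    IsPureState η := by
  refine ⟨hη, fun η₁ h₁ η₂ h₂ hseg => ?_⟩
  refine h.extension_unique h₁ hη (fun b => ?_) e
  obtain ⟨s, t, hs, ht, hst, hη'⟩ := hseg
  have hr : restrict η₁ = ω := (h.isPureState).2 (IsState.restrict h₁) (IsState.restrict h₂)
    ⟨s, t, hs, ht, hst, ContinuousLinearMap.ext fun b => by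
      rw [← e b, ← hη']
      rfl⟩
  rw [← hr]
  rfl

theorem hasUniqueExtension_diagonal : HasUniqueExtension diagonal := by
  intro ω hω
  obtain ⟨f, h⟩ := (isPureState_iff ω).1 hω
  obtain ⟨ω', h', η, hη, e⟩ := exists_isEvaluation f
  obtain rfl := h.eq h'
  exact ⟨η, ⟨h.isPureState_extension hη e, e⟩, fun η' ⟨hp, e'⟩ => h.extension_unique hp.1 hη e' e⟩

theorem exists_pure_extension {f : Vertex ⊕ Face → ℤˣ} {ω : diagonal →L[ℂ] ℂ}
    (h : IsEvaluation f ω) : ∃ η : Algebra →L[ℂ] ℂ, IsPureState η ∧ Extends ω η ∧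
      ∀ η' : Algebra →L[ℂ] ℂ, IsState η' → Extends ω η' → η' = η := by
  obtain ⟨ω', h', η, hη, e⟩ := exists_isEvaluation f
  obtain rfl := h.eq h'
  exact ⟨η, h.isPureState_extension hη e, e, fun η' hs e' => h.extension_unique hs hη e' e⟩

end ToricCode

/-! ### Maximality by averaging, and regularity -/

namespace ToricCode

open SpinSystem CStarDiagonal

/-- The average of `a` over conjugation by the stabilizer of `w`. -/
def average (w : Vertex ⊕ Face) : Module.End ℂ Algebra :=
  (2⁻¹ : ℂ) • (1 + LinearMap.mulLeft ℂ (stabilizer w) * LinearMap.mulRight ℂ (stabilizer w))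

theorem average_apply (w : Vertex ⊕ Face) (a : Algebra) :
    average w a = (2⁻¹ : ℂ) • (a + stabilizer w * (a * stabilizer w)) := rfl

theorem average_of_comm {w : Vertex ⊕ Face} {a : Algebra}
    (h : stabilizer w * a = a * stabilizer w) : average w a = a := by
  rw [average_apply, ← h, ← mul_assoc, stabilizer_mul_self, one_mul, ← two_smul ℂ, smul_smul,
    inv_mul_cancel₀ two_ne_zero, one_smul]

theorem average_of_anticomm {w : Vertex ⊕ Face} {a : Algebra}
    (h : stabilizer w * a = -(a * stabilizer w)) : average w a = 0 := by
  rw [average_apply, ← mul_assoc, h, neg_mul, mul_assoc, stabilizer_mul_self, mul_one,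
    add_neg_cancel, smul_zero]

theorem norm_stabilizer_le (w : Vertex ⊕ Face) : ‖stabilizer w‖ ≤ 1 := by
  have h : ‖stabilizer w‖ * ‖stabilizer w‖ ≤ 1 := by
    rw [← CStarRing.norm_star_mul_self, star_stabilizer, stabilizer_mul_self]
    exact ContinuousLinearMap.norm_id_le
  nlinarith [norm_nonneg (stabilizer w)]

theorem norm_average_le (w : Vertex ⊕ Face) (a : Algebra) : ‖average w a‖ ≤ ‖a‖ := by
  have h1 : ‖stabilizer w * (a * stabilizer w)‖ ≤ ‖a‖ := by
    calc ‖stabilizer w * (a * stabilizer w)‖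
        ≤ ‖stabilizer w‖ * (‖a‖ * ‖stabilizer w‖) :=
          (norm_mul_le _ _).trans (mul_le_mul_of_nonneg_left (norm_mul_le _ _) (norm_nonneg _))
      _ ≤ 1 * (‖a‖ * 1) := by
          gcongr <;> exact norm_stabilizer_le w
      _ = ‖a‖ := by ring
  rw [average_apply, norm_smul, norm_inv, Complex.norm_ofNat]
  have := norm_add_le a (stabilizer w * (a * stabilizer w))
  linarith

theorem average_mul_comm (w w' : Vertex ⊕ Face) :
    average w * average w' = average w' * average w := by
  refine LinearMap.ext fun a => ?_
  have key : stabilizer w * (stabilizer w' * (a * stabilizer w') * stabilizer w) =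
      stabilizer w' * (stabilizer w * (a * stabilizer w) * stabilizer w') := by
    simp only [← mul_assoc]
    rw [stabilizer_mul_comm w w']
    simp only [mul_assoc]
    rw [stabilizer_mul_comm w w']
  simp only [Module.End.mul_apply, average_apply, smul_add, mul_add, add_mul, mul_smul_comm,
    smul_mul_assoc, key]
  abel

/-- The maps obtained by averaging over finitely many stabilizers. -/
def averages : Submonoid (Module.End ℂ Algebra) := Submonoid.closure (Set.range average)

theorem average_mem (w : Vertex ⊕ Face) : average w ∈ averages :=
  Submonoid.subset_closure ⟨w, rfl⟩

theorem averages_comm {S T : Module.End ℂ Algebra} (hS : S ∈ averages) (hT : T ∈ averages) :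
    S * T = T * S := by
  induction hS, hT using Submonoid.closure_induction₂ with
  | mem S T hS hT =>
    obtain ⟨w, rfl⟩ := hS
    obtain ⟨w', rfl⟩ := hT
    exact average_mul_comm w w'
  | one_left => rw [one_mul, mul_one]
  | one_right => rw [one_mul, mul_one]
  | mul_left x y z _ _ _ h h' => exact (Commute.mul_left (show Commute x z from h) h').eq
  | mul_right x y z _ _ _ h h' => exact (Commute.mul_right (show Commute z x from h) h').eq

theorem norm_le_of_mem_averages {T : Module.End ℂ Algebra} (hT : T ∈ averages) :
    ∀ a, ‖T a‖ ≤ ‖a‖ := by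
  induction hT using Submonoid.closure_induction with
  | mem T h =>
    obtain ⟨w, rfl⟩ := h
    exact norm_average_le w
  | one => exact fun a => le_rfl
  | mul S T _ _ hS hT => exact fun a => (hS _).trans (hT a)

theorem apply_eq_of_mem_averages {T : Module.End ℂ Algebra} (hT : T ∈ averages) {a : Algebra}
    (ha : ∀ w, stabilizer w * a = a * stabilizer w) : T a = a := by
  induction hT using Submonoid.closure_induction with
  | mem T h =>
    obtain ⟨w, rfl⟩ := h
    exact average_of_comm (ha w)
  | one => rfl
  | mul S T _ _ hS hT => rw [Module.End.mul_apply, hT, hS]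

theorem stabilizer_comm_of_mem {a : Algebra} (ha : a ∈ diagonal) (w : Vertex ⊕ Face) :
    stabilizer w * a = a * stabilizer w :=
  congrArg Subtype.val (diagonal_mul_comm (stabilizerElt w) ⟨a, ha⟩)

/-- A string outside `𝒞` is killed by averaging over a stabilizer that anticommutes with it. For a
sum the averages are composed: they commute and fix `𝒞`, so neither spoils what the other has
achieved. -/
theorem exists_average_mem_diagonal {a : Algebra} (ha : a ∈ pauliAlgebra Edge) :
    ∃ T ∈ averages, T a ∈ diagonal := by
  refine pauliAlgebra_induction (p := fun a => ∃ T ∈ averages, T a ∈ diagonal)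
    (fun c x z a ha => ?_) ?_ ?_ ha
  · rcases mem_diagonal_or_anticomm ha with h | ⟨w, hw⟩
    · exact ⟨1, one_mem _, h⟩
    · refine ⟨average w, average_mem w, ?_⟩
      rw [average_of_anticomm hw]
      exact zero_mem _
  · rintro a b ⟨S, hS, ha⟩ ⟨T, hT, hb⟩
    refine ⟨S * T, mul_mem hS hT, ?_⟩
    have h1 : (S * T) a = S a := by
      rw [averages_comm hS hT, Module.End.mul_apply,
        apply_eq_of_mem_averages hT (stabilizer_comm_of_mem ha)]
    have h2 : (S * T) b = T b := by
      rw [Module.End.mul_apply, apply_eq_of_mem_averages hS (stabilizer_comm_of_mem hb)]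
    rw [map_add, h1, h2]
    exact add_mem ha hb
  · rintro c a ⟨S, hS, ha⟩
    refine ⟨S, hS, ?_⟩
    rw [map_smul]
    exact diagonal.smul_mem ha c

theorem isMasa_diagonal : IsMasa diagonal := by
  ext a
  rw [Set.mem_centralizer_iff]
  constructor
  · intro ha
    have ha' : ∀ w, stabilizer w * a = a * stabilizer w := fun w => ha _ (stabilizer_mem w)
    rw [← isClosed_diagonal.closure_eq, Metric.mem_closure_iff]
    intro ε hε
    obtain ⟨b, hb, hab⟩ := Metric.mem_closure_iff.1 (dense_pauliAlgebra a) ε hε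
    -- `T` is a contraction that fixes `a`, so `T b` is as close to `a` as `b` is, and it lies in
    -- `𝒞`.
    obtain ⟨T, hT, hTb⟩ := exists_average_mem_diagonal hb
    refine ⟨T b, hTb, ?_⟩
    rw [dist_eq_norm] at hab ⊢
    rw [← apply_eq_of_mem_averages hT ha', ← map_sub]
    exact (norm_le_of_mem_averages hT _).trans_lt hab
  · intro ha b hb
    exact congrArg Subtype.val (diagonal_mul_comm ⟨b, hb⟩ ⟨a, ha⟩)

/-- A self-adjoint unitary Pauli string is a normalizer. -/
theorem isNormalizer_of_isPauli {c : ℂ} {x z : Edge →₀ ZMod 2} {a : Algebra} (ha : IsPauli c x z a)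
    (hstar : star a = a) (hsq : a * a = 1) : IsNormalizer diagonal a := by
  have h : ∀ b : diagonal, a * b * a ∈ diagonal := fun b => by
    induction b using diagonal_induction with
    | closed => exact isClosed_diagonal.preimage (f := fun b : diagonal => a * b * a) (by fun_prop)
    | stab w =>
      change a * stabilizer w * a ∈ diagonal
      -- Conjugation by a string changes a stabilizer at most by a sign.
      rw [ha.mul_eq (isPauli_stabilizer w), smul_mul_assoc, mul_assoc, hsq, mul_one]
      exact diagonal.smul_mem (stabilizer_mem w) _
    | scalar c =>
      change a * algebraMap ℂ Algebra c * a ∈ diagonal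
      rw [← Algebra.commutes, mul_assoc, hsq, mul_one]
      exact diagonal.algebraMap_mem c
    | add b b' h h' =>
      change a * ((b : Algebra) + b') * a ∈ diagonal
      rw [mul_add, add_mul]
      exact add_mem h h'
    | mul b b' h h' =>
      change a * ((b : Algebra) * b') * a ∈ diagonal
      have e : a * ((b : Algebra) * b') * a = a * b * a * (a * b' * a) := by
        calc a * ((b : Algebra) * b') * a = a * b * 1 * b' * a := by
              rw [mul_one, ← mul_assoc a]
          _ = a * b * a * (a * b' * a) := by
              rw [← hsq]
              simp only [mul_assoc]
      rw [e]
      exact mul_mem h h'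
  intro b hb
  rw [hstar]
  exact ⟨h ⟨b, hb⟩, h ⟨b, hb⟩⟩

theorem single_add_single (e : Edge) :
    (Finsupp.single e 1 + Finsupp.single e 1 : Edge →₀ ZMod 2) = 0 := by
  rw [← Finsupp.single_add, show (1 + 1 : ZMod 2) = 0 by decide, Finsupp.single_zero]

theorem sigmaX_mul_self (e : Edge) : sigmaX e * sigmaX e = 1 := by
  have h := (isPauli_sigmaX e).mul (isPauli_sigmaX e)
  rw [single_add_single, pair_zero_left, sgn_zero, mul_one, mul_one, add_zero] at h
  exact h.ext isPauli_one

theorem sigmaZ_mul_self (e : Edge) : sigmaZ e * sigmaZ e = 1 := by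
  have h := (isPauli_sigmaZ e).mul (isPauli_sigmaZ e)
  rw [single_add_single, Finsupp.coe_zero, pair_zero_right, sgn_zero, mul_one, mul_one,
    add_zero] at h
  exact h.ext isPauli_one

theorem isRegular_diagonal : IsRegular diagonal := by
  have hle : pauliAlgebra Edge ≤
      (StarAlgebra.adjoin ℂ {a : Algebra | IsNormalizer diagonal a}).toSubalgebra := by
    refine Algebra.adjoin_le ?_
    rintro _ (⟨e, rfl⟩ | ⟨e, rfl⟩)
    · exact StarAlgebra.subset_adjoin ℂ _
        (isNormalizer_of_isPauli (isPauli_sigmaX e) (star_sigmaX e) (sigmaX_mul_self e))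
    · exact StarAlgebra.subset_adjoin ℂ _
        (isNormalizer_of_isPauli (isPauli_sigmaZ e) (star_sigmaZ e) (sigmaZ_mul_self e))
  refine StarSubalgebra.eq_top_iff.2 fun a => ?_
  rw [← SetLike.mem_coe, StarSubalgebra.topologicalClosure_coe]
  exact closure_mono hle (dense_pauliAlgebra a)

theorem isCStarDiagonal_diagonal : IsCStarDiagonal diagonal :=
  ⟨isClosed_diagonal, isMasa_diagonal, isRegular_diagonal, hasUniqueExtension_diagonal⟩

end ToricCode

/-! ### The UHF structure -/

namespace SpinSystem

open CStarDiagonal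

variable {E : Type} [DecidableEq E]

theorem range_localElt_mono {Λ Λ' : Finset E} (h : Λ ⊆ Λ') :
    (localElt Λ).range ≤ (localElt Λ').range := by
  rintro _ ⟨a, rfl⟩
  exact ⟨extendMatrix h a, Subtype.ext (localEmbed_extendMatrix h a)⟩

theorem nonempty_range_localElt_equiv {Λ : Finset E} {n : ℕ} (h : Λ.card = n) :
    Nonempty ((localElt Λ).range ≃⋆ₐ[ℂ] Matrix (Fin (2 ^ n)) (Fin (2 ^ n)) ℂ) := by
  have hinj : Function.Injective (localElt Λ) :=
    StarAlgHom.injective_codRestrict (localEmbed Λ) (quasiLocal E) (localEmbed_mem Λ)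
      |>.2 (localEmbed_injective Λ)
  let e : (Λ → Fin 2) ≃ Fin (2 ^ n) := Fintype.equivFinOfCardEq (by simp [h])
  exact ⟨(StarAlgEquiv.ofInjective _ hinj).symm.trans
    (StarAlgEquiv.ofAlgEquiv (Matrix.reindexAlgEquiv ℂ ℂ e) fun m => rfl)⟩

/-- The quasi-local algebra of countably many qubits is the UHF algebra of type `2^∞`. -/
theorem isUHFTwoInfty_quasiLocal [Countable E] [Infinite E] : IsUHFTwoInfty (QuasiLocal E) := by
  obtain ⟨e⟩ : Nonempty (E ≃ ℕ) := nonempty_equiv_of_countable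
  -- The first `n` sites of an enumeration, so that the matrix size is exactly `2 ^ n`.
  let Λ : ℕ → Finset E := fun n => (Finset.range n).map e.symm.toEmbedding
  have hmem : ∀ n x, x ∈ Λ n ↔ e x < n := fun n x => by
    simp [Λ]
  refine ⟨fun n => (localElt (Λ n)).range, fun m n hmn => range_localElt_mono fun x hx => ?_,
    fun n => nonempty_range_localElt_equiv (by simp [Λ]), ?_⟩
  · rw [hmem] at hx ⊢
    omega
  · refine StarSubalgebra.eq_top_iff.2 fun a => ?_
    rw [← SetLike.mem_coe, StarSubalgebra.topologicalClosure_coe]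
    refine closure_mono ?_ (dense_localElt a)
    rintro _ ⟨Γ, m, rfl⟩
    have hsub : Γ ⊆ Λ (Γ.sup e + 1) := fun x hx => by
      rw [hmem]
      exact Nat.lt_succ_of_le (Finset.le_sup (f := e) hx)
    exact le_iSup (fun n => (localElt (Λ n)).range) _ (range_localElt_mono hsub ⟨m, rfl⟩)

end SpinSystem

end

theorem corollary3p7 :
    -- the quasi-local algebra is the UHF algebra of type `2^∞`
    CStarDiagonal.IsUHFTwoInfty ToricCode.Algebra ∧
    -- every `f` defines exactly one evaluation `ω_f`, and these are the pure states of `𝒞`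
    (∀ f : ToricCode.Vertex ⊕ ToricCode.Face → ℤˣ,
      ∃! ω : ToricCode.diagonal →L[ℂ] ℂ, ToricCode.IsEvaluation f ω) ∧
    (∀ ω : ToricCode.diagonal →L[ℂ] ℂ,
      CStarDiagonal.IsPureState ω ↔
        ∃ f : ToricCode.Vertex ⊕ ToricCode.Face → ℤˣ, ToricCode.IsEvaluation f ω) ∧
    -- every `ω_f` has an extension to a pure state, which is its only extension to a state
    (∀ (f : ToricCode.Vertex ⊕ ToricCode.Face → ℤˣ) (ω : ToricCode.diagonal →L[ℂ] ℂ),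
      ToricCode.IsEvaluation f ω →
        ∃ η : ToricCode.Algebra →L[ℂ] ℂ,
          CStarDiagonal.IsPureState η ∧ CStarDiagonal.Extends ω η ∧
          ∀ η' : ToricCode.Algebra →L[ℂ] ℂ,
            CStarDiagonal.IsState η' → CStarDiagonal.Extends ω η' → η' = η) ∧
    -- `𝒞` is a regular masa with the unique extension property
    CStarDiagonal.IsCStarDiagonal ToricCode.diagonal :=
  ⟨SpinSystem.isUHFTwoInfty_quasiLocal,
    fun f =>
      let ⟨ω, h, _⟩ := ToricCode.exists_isEvaluation f
      ⟨ω, h, fun _ h' => h'.eq h⟩,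
    ToricCode.isPureState_iff,
    fun _ _ h => ToricCode.exists_pure_extension h,
    ToricCode.isCStarDiagonal_diagonal⟩
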